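/- Let $M$ be a real random variable with a log-concave probability density $f$, i.e. $f \ge 0$, $\int f = 1$, the set $\{f \neq 0\}$ is an interval and $\log f$ is concave on it; let $-\infty \le m_L < m_U \le \infty$ be the endpoints of this interval, and let $b \in \mathbb{R}$. An encoder policy $\gamma^e$ and a decoder policy $\gamma^d$ are Borel measurable functions $\mathbb{R} \to \mathbb{R}$; their costs are $$J^e(\gamma^e,\gamma^d) = \mathbb{E}\big[(M - \gamma^d(\gamma^e(M)) - b)^2\big], \qquad J^d(\gamma^e,\gamma^d) = \mathbb{E}\big[(M - \gamma^d(\gamma^e(M)))^2\big],$$ and $(\gamma^e,\gamma^d)$ is a Nash equilibrium if neither player can lower his own cost by changing his own policy alone. It is an equilibrium with $N$ bins ($N \geq 1$ finite) if there are edges $m_L = m_0 < m_1 < \dots < m_N = m_U$ such that, up to null sets of the source, $\gamma^e$ is constant on each bin $[m_{k-1}, m_k)$, $k = 1,\dots,N$, with distinct values on distinct bins. Then an equilibrium with more bins is more informative, i.e. it has a smaller cost for both players: for all $1 \le K < N$, every equilibrium $(\gamma^e,\gamma^d)$ with $K$ bins and every equilibrium $(\tilde\gamma^e,\tilde\gamma^d)$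 with $N$ bins satisfy $$J^d(\tilde\gamma^e,\tilde\gamma^d) < J^d(\gamma^e,\gamma^d) \quad\text{and}\quad J^e(\tilde\gamma^e,\tilde\gamma^d) < J^e(\gamma^e,\gamma^d).$$ In particular this holds for $N = K+1$. Moreover, at every equilibrium with finitely many bins both costs are finite and $J^e = J^d + b^2$. -/

import Mathlib

open MeasureTheory
open scoped ENNReal

noncomputable section

namespace CheapTalk

/-- `f` is a probability density function on the real line (with respect to Lebesgue measure). -/
structure IsDensity (f : ℝ → ℝ) : Prop where
  measurable : Measurable f
  nonneg : ∀ x, 0 ≤ f x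
  lintegral_eq_one : ∫⁻ x, ENNReal.ofReal (f x) = 1

/-- `f` is log-concave: its support `{x | f x ≠ 0}` is convex (an interval) and `log f` is concave
there. The density may vanish at the endpoints of its support interval. -/
def IsLogConcave (f : ℝ → ℝ) : Prop :=
  ConcaveOn ℝ (Function.support f) (fun x => Real.log (f x))

/-- The law of the source `M` with density `f`. -/
def sourceLaw (f : ℝ → ℝ) : Measure ℝ :=
  volume.withDensity (fun x => ENNReal.ofReal (f x))

/-- The lower boundary `m_L` of the support; it is `⊥` if the support is unbounded below. -/
def lowerBoundary (f : ℝ → ℝ) : EReal :=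
  sInf ((fun x : ℝ => (x : EReal)) '' Function.support f)

/-- The upper boundary `m_U` of the support; it is `⊤` if the support is unbounded above. -/
def upperBoundary (f : ℝ → ℝ) : EReal :=
  sSup ((fun x : ℝ => (x : EReal)) '' Function.support f)

/-- The expected cost `E[(M - U - b)²]` of the encoder, where `X = γe M` and `U = γd X`.
It is `[0, ∞]`-valued because an arbitrary policy may have infinite cost. -/
def encoderCost (f : ℝ → ℝ) (b : ℝ) (γe γd : ℝ → ℝ) : ℝ≥0∞ :=
  ∫⁻ m, ENNReal.ofReal ((m - γd (γe m) - b) ^ 2) ∂(sourceLaw f)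

/-- The expected cost `E[(M - U)²]` of the decoder, where `X = γe M` and `U = γd X`. -/
def decoderCost (f : ℝ → ℝ) (γe γd : ℝ → ℝ) : ℝ≥0∞ :=
  ∫⁻ m, ENNReal.ofReal ((m - γd (γe m)) ^ 2) ∂(sourceLaw f)

/-- A Nash equilibrium of the simultaneous-move game. The strategy sets are all Borel measurable
(deterministic) functions from `ℝ` to `ℝ`. -/
structure IsNashEquilibrium (f : ℝ → ℝ) (b : ℝ) (γe γd : ℝ → ℝ) : Prop where
  measurable_encoder : Measurable γe
  measurable_decoder : Measurable γd
  encoder_optimal : ∀ γe' : ℝ → ℝ, Measurable γe' →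
    encoderCost f b γe γd ≤ encoderCost f b γe' γd
  decoder_optimal : ∀ γd' : ℝ → ℝ, Measurable γd' →
    decoderCost f γe γd ≤ decoderCost f γe γd'

/-- The encoder policy `γe` is a quantizer with `N` bins for the source `f`: there are edges
`m_L = m_0 < m_1 < ⋯ < m_N = m_U` such that `γe` reports the bin `[m_k, m_{k+1})` in which the
source lies, distinct bins being reported by distinct messages. Policies are taken up to null sets
of the source. -/
def HasBins (f : ℝ → ℝ) (γe : ℝ → ℝ) (N : ℕ) : Prop :=
  ∃ (m : Fin (N + 1) → EReal) (msg : Fin N → ℝ),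
    StrictMono m ∧ m 0 = lowerBoundary f ∧ m (Fin.last N) = upperBoundary f ∧
    Function.Injective msg ∧
    ∀ᵐ x : ℝ ∂(sourceLaw f), ∀ k : Fin N,
      m k.castSucc ≤ (x : EReal) → (x : EReal) < m k.succ → γe x = msg k

/-- A Nash equilibrium with `N` bins. -/
def IsEquilibriumWithBins (f : ℝ → ℝ) (b : ℝ) (N : ℕ) (γe γd : ℝ → ℝ) : Prop :=
  IsNashEquilibrium f b γe γd ∧ HasBins f γe N

end CheapTalk

end

/-! At an equilibrium with finitely many bins the decoder must play the conditional means
(centroids) of the bins. Any edge between two bins must be the encoder's indifference point `(c +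
c') / 2 + b`, since otherwise the encoder gains by re-reporting a short interval next to it. So
equilibria yield fixed points of `edgeMap`, called stationary partitions. The decoder's cost is
their `distortion`, and the encoder pays exactly `b ^ 2` more. It remains to show that stationary
partitions with more cells have smaller distortion.

Log-concavity enters through one inequality, `centroid_shift_le`: translating a cell to the right by
`t` moves its centroid by at most `t`. Together with the monotonicity of centroids in the endpoints,
it gives maximum principles at the edge of largest displacement. `IsStationary.le_of_lt` says that
more cells push the edges to the left. `IsStationary.le_of_same_count` gives uniqueness for a given
number of cells: equality would propagate to every cell and make `f` proportional to a translate of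
itself on the whole line, which is impossible for a density with a mean.

Let `m` and `m'` be stationary with `K < N` cells. Reflection allows `0 ≤ b`. Split the last cell of
`m` close enough to the upper end that the new edge lies to the right of its indifference point
(`IsStationary.exists_split_point`). This lowers the distortion strictly and gives a supersolution
of the monotone map `edgeMap`; the first `K` edges of `m'` form a subsolution below it. The iterates
decrease to a stationary partition with `K + 1` cells (`exists_isStationary_between`). For `0 ≤ b`
the distortion does not increase on the way, because an edge moving left never crosses the midpoint
of its two centroids, so only points nearer to the next centroid change cell. Repeating this up to
`N` cells gives `m'` itself, by uniqueness. -/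

noncomputable section

namespace CheapTalk

open Set Filter Topology

variable {f : ℝ → ℝ}

/-! ### Log-concave densities -/

/-- `f` is a log-concave probability density. -/
structure IsLogConcaveDensity (f : ℝ → ℝ) : Prop where
  isDensity : IsDensity f
  isLogConcave : IsLogConcave f

lemma IsDensity.integrable (hf : IsDensity f) : Integrable f := by
  refine ⟨hf.measurable.aestronglyMeasurable, ?_⟩
  rw [hasFiniteIntegral_iff_ofReal (Eventually.of_forall hf.nonneg), hf.lintegral_eq_one]
  exact ENNReal.one_lt_top

lemma IsDensity.integral_eq_one (hf : IsDensity f) : ∫ x, f x = 1 := by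
  rw [integral_eq_lintegral_of_nonneg_ae (Eventually.of_forall hf.nonneg)
    hf.measurable.aestronglyMeasurable, hf.lintegral_eq_one]
  simp

lemma IsDensity.pos_of_ne_zero (hf : IsDensity f) {x : ℝ} (hx : f x ≠ 0) : 0 < f x :=
  lt_of_le_of_ne (hf.nonneg x) hx.symm

lemma IsDensity.comp_neg (hf : IsDensity f) : IsDensity (fun x => f (-x)) where
  measurable := hf.measurable.comp measurable_neg
  nonneg x := hf.nonneg _
  lintegral_eq_one := by
    rw [← hf.lintegral_eq_one]
    exact lintegral_neg_eq_self (μ := volume) (fun x => ENNReal.ofReal (f x))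

lemma IsLogConcave.comp_neg (hf : IsLogConcave f) : IsLogConcave (fun x => f (-x)) := by
  refine ⟨fun x hx y hy s t hs ht hst => ?_, fun x hx y hy s t hs ht hst => ?_⟩
  · have := hf.1 (x := -x) hx (y := -y) hy hs ht hst
    simp only [Function.mem_support, smul_eq_mul] at this ⊢
    convert this using 2
    ring
  · have := hf.2 (x := -x) hx (y := -y) hy hs ht hst
    simp only [smul_eq_mul] at this ⊢
    convert this using 3
    ring

lemma IsLogConcaveDensity.comp_neg (hf : IsLogConcaveDensity f) :
    IsLogConcaveDensity (fun x => f (-x)) :=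
  ⟨hf.isDensity.comp_neg, hf.isLogConcave.comp_neg⟩

/-- Log-concavity in product form: translates of `f` have a monotone likelihood ratio. -/
lemma IsLogConcaveDensity.mul_le_mul_shift (hf : IsLogConcaveDensity f) {x y t : ℝ} (hxy : x ≤ y)
    (ht : 0 ≤ t) : f x * f (y + t) ≤ f (x + t) * f y := by
  have h0 := hf.isDensity.nonneg
  by_cases hx : f x = 0
  · rw [hx, zero_mul]; exact mul_nonneg (h0 _) (h0 _)
  by_cases hy : f (y + t) = 0
  · rw [hy, mul_zero]; exact mul_nonneg (h0 _) (h0 _)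
  rcases eq_or_lt_of_le (add_nonneg (sub_nonneg.2 hxy) ht) with h | h
  · have h1 : y = x := by linarith
    have h2 : t = 0 := by linarith
    simp [h1, h2]
  have hc := hf.isLogConcave
  set d := y - x + t with hd
  have hs : 0 ≤ t / d := by positivity
  have hs' : 0 ≤ (y - x) / d := div_nonneg (by linarith) h.le
  have hsum : (y - x) / d + t / d = 1 := by rw [← add_div]; exact div_self h.ne'
  have hsum' : t / d + (y - x) / d = 1 := by rw [add_comm]; exact hsum
  -- Both `x + t` and `y` lie between `x` and `y + t`, with the two weights interchanged, so adding
  -- the two concavity inequalities gives the claim.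
  have e1 : (y - x) / d * x + t / d * (y + t) = x + t := by field_simp; rw [hd]; ring
  have e2 : t / d * x + (y - x) / d * (y + t) = y := by field_simp; rw [hd]; ring
  have m1 := hc.1 hx hy hs' hs hsum
  have m2 := hc.1 hx hy hs hs' hsum'
  have i1 := hc.2 hx hy hs' hs hsum
  have i2 := hc.2 hx hy hs hs' hsum'
  simp only [smul_eq_mul, e1, e2, Function.mem_support] at m1 m2 i1 i2
  have hl : Real.log (f x * f (y + t)) ≤ Real.log (f (x + t) * f y) := by
    rw [Real.log_mul hx hy, Real.log_mul m1 m2]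
    have e3 : (y - x) / d = 1 - t / d := by linarith
    rw [e3] at i1 i2
    linarith
  exact (Real.log_le_log_iff (mul_pos (hf.isDensity.pos_of_ne_zero hx)
    (hf.isDensity.pos_of_ne_zero hy)) (mul_pos (hf.isDensity.pos_of_ne_zero m1)
    (hf.isDensity.pos_of_ne_zero m2))).1 hl

/-! ### Exponential tails and finite second moments. -/

lemma IsDensity.exists_ne_zero (hf : IsDensity f) : ∃ x, f x ≠ 0 := by
  by_contra! h
  have := hf.integral_eq_one
  simp [h] at this

/-- An integrable `f` must drop somewhere to the right of a point of its support. From there on the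
concave function `log f` stays below the line through these two points, whose slope is negative. -/
lemma IsLogConcaveDensity.exists_exp_bound (hf : IsLogConcaveDensity f) :
    ∃ C d z : ℝ, 0 ≤ C ∧ 0 < d ∧ 0 ≤ z ∧ ∀ x, z < x → f x ≤ C * Real.exp (-d * x) := by
  have h0 := hf.isDensity.nonneg
  obtain ⟨p, hp⟩ := hf.isDensity.exists_ne_zero
  have hp' := hf.isDensity.pos_of_ne_zero hp
  obtain ⟨q, hpq, hq⟩ : ∃ q, p < q ∧ f q < f p := by
    by_contra! h
    have h1 : IntegrableOn (fun _ : ℝ => f p) (Ioi p) := by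
      refine Integrable.mono' hf.isDensity.integrable.integrableOn
        aestronglyMeasurable_const ?_
      filter_upwards [ae_restrict_mem measurableSet_Ioi] with x hx
      rw [Real.norm_of_nonneg hp'.le]
      exact h x hx
    rw [integrableOn_const_iff] at h1
    simp [hp'.ne'] at h1
  -- Here the support has already ended before `q`, and the bound holds with constant `0`.
  by_cases hq0 : f q = 0
  · refine ⟨0, 1, max q 0, le_rfl, one_pos, le_max_right _ _, fun x hx => ?_⟩
    rw [zero_mul]
    by_contra! hx0
    have hqx : q < x := (le_max_left _ _).trans_lt hx
    exact (hf.isLogConcave.1.ordConnected.out hp hx0.ne' ⟨hpq.le, hqx.le⟩) hq0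
  have hq' := hf.isDensity.pos_of_ne_zero hq0
  have hL : Real.log (f q) < Real.log (f p) := Real.log_lt_log hq' hq
  set d := (Real.log (f p) - Real.log (f q)) / (q - p) with hd
  have hdpos : 0 < d := div_pos (by linarith) (by linarith)
  refine ⟨Real.exp (Real.log (f q) + d * q), d, max q 0, (Real.exp_pos _).le, hdpos,
    le_max_right _ _, fun x hx => ?_⟩
  have hqx : q < x := (le_max_left _ _).trans_lt hx
  by_cases hx0 : f x = 0
  · rw [hx0]; positivity
  have h1 := hf.isLogConcave.slope_anti_adjacent (x := p) (y := q) (z := x) hp hx0 hpq hqx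
  rw [div_le_iff₀ (by linarith)] at h1
  have h2 : (Real.log (f q) - Real.log (f p)) / (q - p) = -d := by rw [hd]; ring
  rw [h2] at h1
  rw [← Real.exp_add, ← Real.exp_log (hf.isDensity.pos_of_ne_zero hx0)]
  apply Real.exp_le_exp.2
  linarith

lemma IsLogConcaveDensity.integrableOn_sq_mul_Ioi (hf : IsLogConcaveDensity f) :
    IntegrableOn (fun x => x ^ 2 * f x) (Ioi 0) := by
  have h0 := hf.isDensity.nonneg
  obtain ⟨C, d, z, hC, hd, hz, hb⟩ := hf.exists_exp_bound
  have h1 := (integrableOn_rpow_mul_exp_neg_mul_rpow (p := 1) (s := 2) (b := d)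
    (by norm_num) one_pos hd).const_mul C
  have h2 := (hf.isDensity.integrable.const_mul (z ^ 2)).integrableOn (s := Ioi (0 : ℝ))
  refine Integrable.mono' (h2.add h1) ((measurable_id.pow_const 2).mul
    hf.isDensity.measurable).aestronglyMeasurable ?_
  filter_upwards [ae_restrict_mem measurableSet_Ioi] with x hx
  have hx' : (0 : ℝ) < x := hx
  simp only [Pi.add_apply, Real.rpow_two, Real.rpow_one]
  rw [Real.norm_of_nonneg (mul_nonneg (sq_nonneg x) (h0 x))]
  rcases le_or_gt x z with h | h
  · have : x ^ 2 * f x ≤ z ^ 2 * f x := by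
      apply mul_le_mul_of_nonneg_right _ (h0 x); gcongr
    have : 0 ≤ C * (x ^ 2 * Real.exp (-d * x)) := by positivity
    linarith
  · have h3 := mul_le_mul_of_nonneg_left (hb x h) (sq_nonneg x)
    have : 0 ≤ z ^ 2 * f x := mul_nonneg (sq_nonneg _) (h0 x)
    linarith

lemma IsLogConcaveDensity.integrable_sq_mul (hf : IsLogConcaveDensity f) :
    Integrable (fun x => x ^ 2 * f x) := by
  rw [← integrableOn_univ, ← Iic_union_Ioi (a := (0 : ℝ))]
  refine IntegrableOn.union ?_ hf.integrableOn_sq_mul_Ioi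
  rw [integrableOn_Iic_iff_integrableOn_Iio]
  have h := hf.comp_neg.integrableOn_sq_mul_Ioi
  have h2 := IntegrableOn.comp_neg_Iio (c := (0 : ℝ)) (by simpa using h)
  simpa using h2

lemma IsLogConcaveDensity.integrable_mul (hf : IsLogConcaveDensity f) :
    Integrable (fun x => x * f x) := by
  refine Integrable.mono' (hf.isDensity.integrable.add hf.integrable_sq_mul)
    (measurable_id.mul hf.isDensity.measurable).aestronglyMeasurable
    (Eventually.of_forall fun x => ?_)
  have h0 := hf.isDensity.nonneg x
  simp only [Pi.add_apply, norm_mul, Real.norm_eq_abs, abs_of_nonneg h0]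
  have : |x| ≤ 1 + x ^ 2 := by
    rw [abs_le]; constructor <;> nlinarith [sq_nonneg (x + 1), sq_nonneg (x - 1)]
  nlinarith

/-- The interior of the support interval. -/
def core (f : ℝ → ℝ) : Set ℝ := interior (Function.support f)

lemma isOpen_core : IsOpen (core f) := isOpen_interior

lemma core_subset_support : core f ⊆ Function.support f := interior_subset

lemma IsLogConcaveDensity.pos_of_mem_core (hf : IsLogConcaveDensity f) {x : ℝ} (hx : x ∈ core f) :
    0 < f x := hf.isDensity.pos_of_ne_zero (core_subset_support hx)

lemma IsLogConcaveDensity.ordConnected_core (hf : IsLogConcaveDensity f) :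
    (core f).OrdConnected := hf.isLogConcave.1.interior.ordConnected

lemma IsLogConcaveDensity.mem_core_of_lt_of_lt (hf : IsLogConcaveDensity f) {x y z : ℝ}
    (hx : f x ≠ 0) (hz : f z ≠ 0) (hxy : x < y) (hyz : y < z) : y ∈ core f := by
  refine mem_interior.2 ⟨Ioo x z, fun w hw => ?_, isOpen_Ioo, hxy, hyz⟩
  exact hf.isLogConcave.1.ordConnected.out hx hz ⟨hw.1.le, hw.2.le⟩

lemma IsLogConcaveDensity.core_nonempty (hf : IsLogConcaveDensity f) : (core f).Nonempty := by
  obtain ⟨p, hp⟩ := hf.isDensity.exists_ne_zero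
  obtain ⟨q, hpq, hq⟩ : ∃ q, q ≠ p ∧ f q ≠ 0 := by
    by_contra! h
    have h1 : f =ᵐ[volume] fun _ => (0 : ℝ) := by
      filter_upwards [compl_mem_ae_iff.2 (measure_singleton p)] with x hx
      exact h x hx
    have := hf.isDensity.integral_eq_one
    rw [integral_congr_ae h1] at this
    simp at this
  rcases lt_or_gt_of_ne hpq with h | h
  · obtain ⟨w, hw⟩ := exists_between h
    exact ⟨w, hf.mem_core_of_lt_of_lt hq hp hw.1 hw.2⟩
  · obtain ⟨w, hw⟩ := exists_between h
    exact ⟨w, hf.mem_core_of_lt_of_lt hp hq hw.1 hw.2⟩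

/-- The frontier of a convex set is a null set. -/
lemma IsLogConcaveDensity.ae_mem_core (hf : IsLogConcaveDensity f) :
    ∀ᵐ x : ℝ, f x ≠ 0 → x ∈ core f := by
  have h := hf.isLogConcave.1.addHaar_frontier volume
  filter_upwards [compl_mem_ae_iff.2 h] with x hx hx0
  by_contra hc
  exact hx ⟨subset_closure hx0, hc⟩

lemma IsLogConcaveDensity.continuousOn_core (hf : IsLogConcaveDensity f) :
    ContinuousOn f (core f) := by
  have h := Real.continuous_exp.comp_continuousOn hf.isLogConcave.continuousOn_interior
  refine h.congr fun x hx => ?_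
  simp [Real.exp_log (hf.pos_of_mem_core hx)]

lemma exists_gt_mem_core {x : ℝ} (hx : x ∈ core f) :
    ∃ y > x, y ∈ core f := by
  obtain ⟨l, u, hlu, h⟩ := mem_nhds_iff_exists_Ioo_subset.1 (isOpen_core.mem_nhds hx)
  obtain ⟨y, hy⟩ := exists_between hlu.2
  exact ⟨y, hy.1, h ⟨hlu.1.trans hy.1, hy.2⟩⟩

/-! ### Cells and their centroids -/

/-- The real numbers in the half-open interval `[a, y)` with extended real endpoints. -/
def cell (a y : EReal) : Set ℝ := {x : ℝ | a ≤ (x : EReal) ∧ (x : EReal) < y}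

lemma mem_cell {a y : EReal} {x : ℝ} : x ∈ cell a y ↔ a ≤ (x : EReal) ∧ (x : EReal) < y := Iff.rfl

lemma measurableSet_cell (a y : EReal) : MeasurableSet (cell a y) :=
  measurable_coe_real_ereal measurableSet_Ico

lemma cell_self (a : EReal) : cell a a = ∅ := by
  ext x; simp only [mem_cell, mem_empty_iff_false, iff_false, not_and, not_lt]; exact id

lemma cell_bot_top : cell ⊥ ⊤ = univ := by
  ext x; simp [mem_cell, EReal.coe_lt_top]

lemma cell_union {a y z : EReal} (h : a ≤ y) (h' : y ≤ z) : cell a y ∪ cell y z = cell a z := by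
  ext x
  simp only [mem_union, mem_cell]
  constructor
  · rintro (h1 | h1)
    · exact ⟨h1.1, h1.2.trans_le h'⟩
    · exact ⟨h.trans h1.1, h1.2⟩
  · rintro ⟨h1, h2⟩
    rcases lt_or_ge (x : EReal) y with h3 | h3
    · exact Or.inl ⟨h1, h3⟩
    · exact Or.inr ⟨h3, h2⟩

lemma disjoint_cell (a y z : EReal) : Disjoint (cell a y) (cell y z) :=
  disjoint_left.2 fun _ h1 h2 => absurd h1.2 (not_lt.2 h2.1)

lemma setIntegral_cell_add {h : ℝ → ℝ} (hh : Integrable h) {a y z : EReal} (h1 : a ≤ y)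
    (h2 : y ≤ z) : ∫ x in cell a z, h x = (∫ x in cell a y, h x) + ∫ x in cell y z, h x := by
  rw [← cell_union h1 h2, setIntegral_union (disjoint_cell a y z) (measurableSet_cell _ _)
    hh.integrableOn hh.integrableOn]

/-- The probability of a cell. -/
def mass (f : ℝ → ℝ) (a y : EReal) : ℝ := ∫ x in cell a y, f x

/-- The first moment of a cell. -/
def moment (f : ℝ → ℝ) (a y : EReal) : ℝ := ∫ x in cell a y, x * f x

/-- The conditional mean of the source in a cell. -/
def centroid (f : ℝ → ℝ) (a y : EReal) : ℝ := moment f a y / mass f a y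

/-- The contribution of a cell to the quadratic distortion if it is represented by `u`. -/
def cellCost (f : ℝ → ℝ) (u : ℝ) (a y : EReal) : ℝ := ∫ x in cell a y, (x - u) ^ 2 * f x

lemma IsLogConcaveDensity.integrable_sub_sq_mul (hf : IsLogConcaveDensity f) (u : ℝ) :
    Integrable (fun x => (x - u) ^ 2 * f x) := by
  refine ((hf.integrable_sq_mul.sub (hf.integrable_mul.const_mul (2 * u))).add
    (hf.isDensity.integrable.const_mul (u ^ 2))).congr (Eventually.of_forall fun x => ?_)
  simp only [Pi.add_apply, Pi.sub_apply]
  ring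

lemma IsLogConcaveDensity.integrable_sub_mul (hf : IsLogConcaveDensity f) (u : ℝ) :
    Integrable (fun x => (x - u) * f x) := by
  refine (hf.integrable_mul.sub (hf.isDensity.integrable.const_mul u)).congr
    (Eventually.of_forall fun x => ?_)
  simp only [Pi.sub_apply]
  ring

lemma mass_nonneg (hf : IsLogConcaveDensity f) (a y : EReal) : 0 ≤ mass f a y :=
  integral_nonneg hf.isDensity.nonneg

lemma mass_add (hf : IsLogConcaveDensity f) {a y z : EReal} (h1 : a ≤ y) (h2 : y ≤ z) :
    mass f a z = mass f a y + mass f y z :=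
  setIntegral_cell_add hf.isDensity.integrable h1 h2

lemma moment_add (hf : IsLogConcaveDensity f) {a y z : EReal} (h1 : a ≤ y) (h2 : y ≤ z) :
    moment f a z = moment f a y + moment f y z :=
  setIntegral_cell_add hf.integrable_mul h1 h2

lemma cellCost_add (hf : IsLogConcaveDensity f) (u : ℝ) {a y z : EReal} (h1 : a ≤ y)
    (h2 : y ≤ z) : cellCost f u a z = cellCost f u a y + cellCost f u y z :=
  setIntegral_cell_add (hf.integrable_sub_sq_mul u) h1 h2

lemma cellCost_self (f : ℝ → ℝ) (u : ℝ) (a : EReal) : cellCost f u a a = 0 := by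
  simp [cellCost, cell_self]

lemma setIntegral_sub_mul (hf : IsLogConcaveDensity f) (u : ℝ) (a y : EReal) :
    ∫ x in cell a y, (x - u) * f x = moment f a y - u * mass f a y := by
  rw [moment, mass, ← integral_const_mul, ← integral_sub hf.integrable_mul.integrableOn
    (hf.isDensity.integrable.const_mul u).integrableOn]
  congr 1; ext x; ring

lemma cellCost_eq (hf : IsLogConcaveDensity f) (u : ℝ) (a y : EReal) :
    cellCost f u a y =
      (∫ x in cell a y, x ^ 2 * f x) - 2 * u * moment f a y + u ^ 2 * mass f a y := by
  rw [cellCost, moment, mass, ← integral_const_mul, ← integral_const_mul,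
    ← integral_sub hf.integrable_sq_mul.integrableOn
      (hf.integrable_mul.const_mul (2 * u)).integrableOn,
    ← integral_add (by
      exact hf.integrable_sq_mul.integrableOn.sub
        (hf.integrable_mul.const_mul (2 * u)).integrableOn)
      (hf.isDensity.integrable.const_mul (u ^ 2)).integrableOn]
  congr 1; ext x; ring

lemma mass_pos (hf : IsLogConcaveDensity f) {a y : EReal} {x : ℝ} (hx : x ∈ core f)
    (hax : a ≤ x) (hxy : (x : EReal) < y) : 0 < mass f a y := by
  rw [mass, setIntegral_pos_iff_support_of_nonneg_ae (Eventually.of_forall hf.isDensity.nonneg)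
    hf.isDensity.integrable.integrableOn]
  obtain ⟨l, u, hlu, h⟩ := mem_nhds_iff_exists_Ioo_subset.1 (isOpen_core.mem_nhds hx)
  obtain ⟨z, hz1, hz2⟩ := EReal.lt_iff_exists_real_btwn.1 hxy
  have hz1' : x < z := by exact_mod_cast hz1
  have hsub : Ioo x (min u z) ⊆ Function.support f ∩ cell a y := fun w hw => by
    have hwu := (lt_min_iff.1 hw.2)
    refine ⟨core_subset_support (h ⟨hlu.1.trans hw.1, hwu.1⟩), hax.trans ?_, lt_trans ?_ hz2⟩
    · exact_mod_cast hw.1.le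
    · exact_mod_cast hwu.2
  refine lt_of_lt_of_le ?_ (measure_mono hsub)
  rw [Real.volume_Ioo, ENNReal.ofReal_pos, sub_pos]
  exact lt_min hlu.2 hz1'

lemma moment_eq (a y : EReal) (h : 0 < mass f a y) :
    moment f a y = centroid f a y * mass f a y := by
  rw [centroid, div_mul_cancel₀ _ h.ne']

/-- The parallel axis identity: the centroid is the unique best representative, with an explicit
quadratic excess for any other. -/
lemma cellCost_eq_centroid (hf : IsLogConcaveDensity f) (u : ℝ) {a y : EReal}
    (h : 0 < mass f a y) : cellCost f u a y =
      cellCost f (centroid f a y) a y + mass f a y * (u - centroid f a y) ^ 2 := by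
  rw [cellCost_eq hf, cellCost_eq hf, moment_eq a y h]
  ring

/-- If the support inside a cell lies weakly to the left of `w`, its mean lies strictly to the left. -/
lemma moment_lt_of_le (hf : IsLogConcaveDensity f) {a y : EReal} (h : 0 < mass f a y) {w : ℝ}
    (hw : ∀ x ∈ cell a y, f x ≠ 0 → x ≤ w) : moment f a y < w * mass f a y := by
  have hnn : ∀ x ∈ cell a y, 0 ≤ (w - x) * f x := fun x hx => by
    by_cases h0 : f x = 0
    · simp [h0]
    · exact mul_nonneg (sub_nonneg.2 (hw x hx h0)) (hf.isDensity.nonneg x)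
  have hint : Integrable (fun x => (w - x) * f x) :=
    (hf.integrable_sub_mul w).neg.congr (Eventually.of_forall fun x => by
      simp only [Pi.neg_apply]; ring)
  have heq : ∫ x in cell a y, (w - x) * f x = w * mass f a y - moment f a y := by
    have := setIntegral_sub_mul hf w a y
    have h2 : ∫ x in cell a y, (w - x) * f x = - ∫ x in cell a y, (x - w) * f x := by
      rw [← integral_neg]; congr 1; ext x; ring
    rw [h2, this]; ring
  have h0 : 0 ≤ ∫ x in cell a y, (w - x) * f x :=
    setIntegral_nonneg (measurableSet_cell _ _) hnn
  rcases h0.eq_or_lt with h1 | h1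
  · exfalso
    have h2 := (setIntegral_eq_zero_iff_of_nonneg_ae
      (ae_restrict_of_forall_mem (measurableSet_cell a y) hnn) hint.integrableOn).1 h1.symm
    have h3 : f =ᵐ[volume.restrict (cell a y)] fun _ => (0 : ℝ) := by
      filter_upwards [h2, ae_restrict_of_ae (compl_mem_ae_iff.2 (measure_singleton (μ := volume) w))]
        with x hx hxw
      rcases mul_eq_zero.1 hx with h4 | h4
      · exact absurd (by rw [mem_singleton_iff]; linarith) hxw
      · exact h4
    rw [mass, integral_congr_ae h3] at h
    simp at h
  · linarith

lemma lt_moment_of_le (hf : IsLogConcaveDensity f) {a y : EReal} (h : 0 < mass f a y) {w : ℝ}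
    (hw : ∀ x ∈ cell a y, f x ≠ 0 → w ≤ x) : w * mass f a y < moment f a y := by
  have hnn : ∀ x ∈ cell a y, 0 ≤ (x - w) * f x := fun x hx => by
    by_cases h0 : f x = 0
    · simp [h0]
    · exact mul_nonneg (sub_nonneg.2 (hw x hx h0)) (hf.isDensity.nonneg x)
  have heq := setIntegral_sub_mul hf w a y
  have h0 : 0 ≤ ∫ x in cell a y, (x - w) * f x :=
    setIntegral_nonneg (measurableSet_cell _ _) hnn
  rcases h0.eq_or_lt with h1 | h1
  · exfalso
    have h2 := (setIntegral_eq_zero_iff_of_nonneg_ae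
      (ae_restrict_of_forall_mem (measurableSet_cell a y) hnn)
      (hf.integrable_sub_mul w).integrableOn).1 h1.symm
    have h3 : f =ᵐ[volume.restrict (cell a y)] fun _ => (0 : ℝ) := by
      filter_upwards [h2, ae_restrict_of_ae (compl_mem_ae_iff.2 (measure_singleton (μ := volume) w))]
        with x hx hxw
      rcases mul_eq_zero.1 hx with h4 | h4
      · exact absurd (by rw [mem_singleton_iff]; linarith) hxw
      · exact h4
    rw [mass, integral_congr_ae h3] at h
    simp at h
  · linarith

lemma centroid_lt_of_le (hf : IsLogConcaveDensity f) {a y : EReal} (h : 0 < mass f a y) {w : ℝ}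
    (hw : ∀ x ∈ cell a y, f x ≠ 0 → x ≤ w) : centroid f a y < w :=
  (div_lt_iff₀ h).2 (moment_lt_of_le hf h hw)

lemma lt_centroid_of_le (hf : IsLogConcaveDensity f) {a y : EReal} (h : 0 < mass f a y) {w : ℝ}
    (hw : ∀ x ∈ cell a y, f x ≠ 0 → w ≤ x) : w < centroid f a y :=
  (lt_div_iff₀ h).2 (lt_moment_of_le hf h hw)

lemma centroid_lt_right (hf : IsLogConcaveDensity f) {a : EReal} {y : ℝ} (h : 0 < mass f a y) :
    centroid f a y < y :=
  centroid_lt_of_le hf h fun x hx _ => by exact_mod_cast hx.2.le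

lemma left_lt_centroid (hf : IsLogConcaveDensity f) {a : ℝ} {y : EReal} (h : 0 < mass f a y) :
    a < centroid f a y :=
  lt_centroid_of_le hf h fun x hx _ => by exact_mod_cast hx.1

/-- This makes `f` positive at the centroid, so likelihood ratios can be normalised there. -/
lemma centroid_mem_core (hf : IsLogConcaveDensity f) {a y : EReal} (h : 0 < mass f a y) :
    centroid f a y ∈ core f := by
  have hex : ∀ w, (∀ x, f x ≠ 0 → x ≤ w) → centroid f a y < w := fun w hw =>
    centroid_lt_of_le hf h fun x _ => hw x
  have hex' : ∀ w, (∀ x, f x ≠ 0 → w ≤ x) → w < centroid f a y := fun w hw =>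
    lt_centroid_of_le hf h fun x _ => hw x
  obtain ⟨p, hp, hp1⟩ : ∃ p, f p ≠ 0 ∧ centroid f a y < p := by
    by_contra! hc; exact lt_irrefl _ (hex _ hc)
  obtain ⟨q, hq, hq1⟩ : ∃ q, f q ≠ 0 ∧ q < centroid f a y := by
    by_contra! hc; exact lt_irrefl _ (hex' _ hc)
  exact hf.mem_core_of_lt_of_lt hq hp hq1 hp1

/-- The centroid of a union is a weighted mean of the centroids of the parts, and these are
separated by the common endpoint `y`. -/
lemma centroid_lt_centroid_right (hf : IsLogConcaveDensity f) {a y z : EReal}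
    (h : 0 < mass f a y) (hay : a ≤ y) (h1 : 0 < mass f y z) (hyz : y ≤ z) :
    centroid f a y < centroid f a z := by
  have hm := mass_add hf hay hyz
  have hM := moment_add hf hay hyz
  -- An infinite `y` would leave one of the two cells empty, contrary to positive mass.
  have hy : ∃ r : ℝ, y = r := by
    induction y using EReal.rec with
    | bot => rw [le_bot_iff.1 hay] at h; simp [mass, cell_self] at h
    | coe r => exact ⟨r, rfl⟩
    | top => rw [top_le_iff.1 hyz] at h1; simp [mass, cell_self] at h1
  obtain ⟨r, rfl⟩ := hy
  have h2 := centroid_lt_right hf h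
  have h3 := left_lt_centroid hf h1
  rw [show centroid f a z = moment f a z / mass f a z from rfl,
    lt_div_iff₀ (by linarith), hm, hM, moment_eq a r h, moment_eq _ z h1]
  nlinarith

lemma centroid_mono_right (hf : IsLogConcaveDensity f) {a y z : EReal} (h : 0 < mass f a y)
    (hay : a ≤ y) (hyz : y ≤ z) : centroid f a y ≤ centroid f a z := by
  have hm := mass_add hf hay hyz
  have hM := moment_add hf hay hyz
  have h0 := mass_nonneg hf y z
  rcases h0.eq_or_lt with h1 | h1
  · have h2 : moment f y z = 0 := by
      have h3 := (setIntegral_eq_zero_iff_of_nonneg_ae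
        (Eventually.of_forall hf.isDensity.nonneg) hf.isDensity.integrable.integrableOn).1
        (show ∫ x in cell y z, f x = 0 from h1.symm)
      rw [moment, integral_congr_ae (g := fun _ => (0 : ℝ))]
      · simp
      · filter_upwards [h3] with x hx
        simp only [Pi.zero_apply] at hx
        simp [hx]
    rw [centroid, centroid, hm, hM, h2, ← h1]; simp
  · exact (centroid_lt_centroid_right hf h hay h1 hyz).le

lemma centroid_lt_centroid_left (hf : IsLogConcaveDensity f) {a y z : EReal}
    (h : 0 < mass f a y) (hay : a ≤ y) (h1 : 0 < mass f y z) (hyz : y ≤ z) :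
    centroid f a z < centroid f y z := by
  have hm := mass_add hf hay hyz
  have hM := moment_add hf hay hyz
  have hy : ∃ r : ℝ, y = r := by
    induction y using EReal.rec with
    | bot => rw [le_bot_iff.1 hay] at h; simp [mass, cell_self] at h
    | coe r => exact ⟨r, rfl⟩
    | top => rw [top_le_iff.1 hyz] at h1; simp [mass, cell_self] at h1
  obtain ⟨r, rfl⟩ := hy
  have h2 := centroid_lt_right hf h
  have h3 := left_lt_centroid hf h1
  rw [centroid, div_lt_iff₀ (by linarith), hm, hM, moment_eq a r h, moment_eq _ z h1]
  nlinarith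

lemma centroid_mono_left (hf : IsLogConcaveDensity f) {a y z : EReal} (h : 0 < mass f y z)
    (hay : a ≤ y) (hyz : y ≤ z) : centroid f a z ≤ centroid f y z := by
  rcases (mass_nonneg hf a y).eq_or_lt with h1 | h1
  · have hm := mass_add hf hay hyz
    have hM := moment_add hf hay hyz
    have h2 : moment f a y = 0 := by
      have h3 := (setIntegral_eq_zero_iff_of_nonneg_ae
        (Eventually.of_forall hf.isDensity.nonneg) hf.isDensity.integrable.integrableOn).1
        (show ∫ x in cell a y, f x = 0 from h1.symm)
      rw [moment, integral_congr_ae (g := fun _ => (0 : ℝ))]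
      · simp
      · filter_upwards [h3] with x hx
        simp only [Pi.zero_apply] at hx
        simp [hx]
    rw [centroid, centroid, hm, hM, h2, ← h1]; simp
  · exact (centroid_lt_centroid_left hf h1 hay h hyz).le

lemma mass_pos_of_left_mem (hf : IsLogConcaveDensity f) {a : ℝ} {y : EReal} (ha : a ∈ core f)
    (hay : (a : EReal) < y) : 0 < mass f a y := mass_pos hf ha le_rfl hay

lemma mass_pos_of_right_mem (hf : IsLogConcaveDensity f) {a : EReal} {y : ℝ} (hy : y ∈ core f)
    (hay : a < y) : 0 < mass f a y := by
  obtain ⟨l, u, hlu, h⟩ := mem_nhds_iff_exists_Ioo_subset.1 (isOpen_core.mem_nhds hy)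
  have h1 : max a l < (y : EReal) := max_lt hay (by exact_mod_cast hlu.1)
  obtain ⟨z, hz1, hz2⟩ := EReal.lt_iff_exists_real_btwn.1 h1
  have hz3 := max_lt_iff.1 hz1
  have hzl : l < z := by exact_mod_cast hz3.2
  have hzy : z < y := by exact_mod_cast hz2
  exact mass_pos hf (h ⟨hzl, hzy.trans hlu.2⟩) hz3.1.le hz2

lemma mass_bot_top_pos (hf : IsLogConcaveDensity f) : 0 < mass f ⊥ ⊤ := by
  obtain ⟨x, hx⟩ := hf.core_nonempty
  exact mass_pos hf hx bot_le (EReal.coe_lt_top x)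

lemma le_of_mass_pos {a y : EReal} (h : 0 < mass f a y) : a ≤ y := by
  by_contra! hc
  have : cell a y = ∅ := by
    ext x; simp only [mem_cell, mem_empty_iff_false, iff_false, not_and, not_lt]
    exact fun h => hc.le.trans h
  simp [mass, this] at h

lemma centroid_mono (hf : IsLogConcaveDensity f) {a y a' y' : EReal} (h : 0 < mass f a y)
    (h' : 0 < mass f a' y') (ha : a ≤ a') (hy : y ≤ y') : centroid f a y ≤ centroid f a' y' :=
  (centroid_mono_right hf h (le_of_mass_pos h) hy).trans
    (centroid_mono_left hf h' ha (le_of_mass_pos h'))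

/-! ### Centroids under translation of the cell. -/

lemma add_mem_cell {a y : EReal} {x t : ℝ} :
    x + t ∈ cell (a + t) (y + t) ↔ x ∈ cell a y := by
  have key : ∀ {p q : EReal}, p + (t : EReal) < q + t ↔ p < q := by
    intro p q
    constructor
    · intro h
      by_contra! hc
      exact absurd h (not_lt.2 (add_le_add_left hc _))
    · exact fun h => EReal.add_lt_add_right_coe h t
  rw [mem_cell, mem_cell, EReal.coe_add, key, ← not_lt, key, not_lt]

lemma setIntegral_cell_shift (h : ℝ → ℝ) (a y : EReal) (t : ℝ) :
    ∫ x in cell (a + t) (y + t), h x = ∫ x in cell a y, h (x + t) := by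
  rw [← integral_indicator (measurableSet_cell _ _), ← integral_indicator (measurableSet_cell _ _),
    ← integral_add_right_eq_self _ t]
  congr 1; ext x
  by_cases hx : x ∈ cell a y
  · rw [indicator_of_mem hx, indicator_of_mem (add_mem_cell.2 hx)]
  · rw [indicator_of_notMem hx, indicator_of_notMem (fun hc => hx (add_mem_cell.1 hc))]

/-- The ratio `f (x + t) / f x` is nonincreasing on the support, so it lies above its value at `c`
on the left of `c` and below it on the right. -/
lemma likelihood_ratio_bound (hf : IsLogConcaveDensity f) {c t : ℝ} (ht : 0 ≤ t)
    (hc : c ∈ core f) (x : ℝ) : 0 ≤ (x - c) * (f (c + t) / f c * f x - f (x + t)) := by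
  have hpos := hf.pos_of_mem_core hc
  rcases le_total x c with h | h
  · have h1 := hf.mul_le_mul_shift h ht
    apply mul_nonneg_of_nonpos_of_nonpos (by linarith)
    rw [sub_nonpos, div_mul_eq_mul_div, div_le_iff₀ hpos]
    linarith
  · have h1 := hf.mul_le_mul_shift h ht
    apply mul_nonneg (by linarith)
    rw [sub_nonneg, div_mul_eq_mul_div, le_div_iff₀ hpos]
    linarith

/-- The `r` term drops out because `x - centroid f a y` has mean zero on the cell; the translated
term measures the displacement of the centroid. With `r` the ratio at the centroid the integrand is
nonnegative, and this yields both the shift inequality and its equality case. -/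
lemma integral_likelihood_ratio (hf : IsLogConcaveDensity f) {a y : EReal} {t : ℝ}
    (h : 0 < mass f a y) (h' : 0 < mass f (a + t) (y + t)) (r : ℝ) :
    Integrable (fun x => (x - centroid f a y) * (r * f x - f (x + t))) ∧
    ∫ x in cell a y, (x - centroid f a y) * (r * f x - f (x + t)) =
      (centroid f a y + t - centroid f (a + t) (y + t)) * mass f (a + t) (y + t) := by
  set c := centroid f a y with hc
  have i1 := (hf.integrable_sub_mul c).const_mul r
  have i2 : Integrable (fun x => (x - c) * f (x + t)) :=
    ((hf.integrable_sub_mul (c + t)).comp_add_right t).congr (Eventually.of_forall fun x => by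
      simp only; ring_nf)
  have e : (fun x => (x - c) * (r * f x - f (x + t))) =
      fun x => r * ((x - c) * f x) - (x - c) * f (x + t) := by ext x; ring
  rw [e]
  refine ⟨i1.sub i2, ?_⟩
  rw [integral_sub i1.integrableOn i2.integrableOn, integral_const_mul, setIntegral_sub_mul hf,
    moment_eq a y h, ← hc]
  have e2 : ∫ x in cell a y, (x - c) * f (x + t) =
      ∫ x in cell (a + t) (y + t), (x - (c + t)) * f x := by
    rw [setIntegral_cell_shift]; congr 1; ext x; ring
  rw [e2, setIntegral_sub_mul hf, moment_eq _ _ h']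
  ring

/-- Shifting a cell to the right by `t` moves its centroid by at most `t`. -/
lemma centroid_shift_le (hf : IsLogConcaveDensity f) {a y : EReal} {t : ℝ} (ht : 0 ≤ t)
    (h : 0 < mass f a y) (h' : 0 < mass f (a + t) (y + t)) :
    centroid f (a + t) (y + t) ≤ centroid f a y + t := by
  have hc := centroid_mem_core hf h
  obtain ⟨_, h2⟩ := integral_likelihood_ratio hf h h'
    (f (centroid f a y + t) / f (centroid f a y))
  have h3 : 0 ≤ ∫ x in cell a y, (x - centroid f a y) *
      (f (centroid f a y + t) / f (centroid f a y) * f x - f (x + t)) :=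
    integral_nonneg fun x => likelihood_ratio_bound hf ht hc x
  rw [h2] at h3
  have := nonneg_of_mul_nonneg_left h3 h'
  linarith

lemma ae_eq_of_centroid_shift_eq (hf : IsLogConcaveDensity f) {a y : EReal} {t : ℝ} (ht : 0 ≤ t)
    (h : 0 < mass f a y) (h' : 0 < mass f (a + t) (y + t))
    (heq : centroid f (a + t) (y + t) = centroid f a y + t) :
    ∃ r : ℝ, ∀ᵐ x : ℝ, x ∈ cell a y → f (x + t) = r * f x := by
  have hc := centroid_mem_core hf h
  obtain ⟨h1, h2⟩ := integral_likelihood_ratio hf h h'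
    (f (centroid f a y + t) / f (centroid f a y))
  refine ⟨f (centroid f a y + t) / f (centroid f a y), ?_⟩
  rw [heq, sub_self, zero_mul] at h2
  have h3 := (setIntegral_eq_zero_iff_of_nonneg_ae
    (Eventually.of_forall fun x => likelihood_ratio_bound hf ht hc x) h1.integrableOn).1 h2
  have h4 := (ae_restrict_iff' (measurableSet_cell a y)).1 h3
  filter_upwards [h4, compl_mem_ae_iff.2 (measure_singleton (μ := volume) (centroid f a y))]
    with x hx hxc hxm
  rcases mul_eq_zero.1 (hx hxm) with h5 | h5
  · exact absurd (by rw [mem_singleton_iff]; linarith) hxc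
  · linarith

/-- The form used in the maximum principles: the cell `[a', y')` is compared with a translated cell
lying to its right. -/
lemma centroid_le_add (hf : IsLogConcaveDensity f) {a y a' y' : EReal} {t : ℝ} (ht : 0 ≤ t)
    (h : 0 < mass f a y) (hs : 0 < mass f (a + t) (y + t)) (h' : 0 < mass f a' y')
    (ha : a' ≤ a + t) (hy : y' ≤ y + t) : centroid f a' y' ≤ centroid f a y + t :=
  (centroid_mono hf h' hs ha hy).trans (centroid_shift_le hf ht h hs)

/-! ### Continuity of cell integrals and centroids in the endpoints. -/

lemma tendsto_setIntegral_cell {h : ℝ → ℝ} (hh : Integrable h) {a y : EReal} {as ys : ℕ → EReal}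
    (ha : Tendsto as atTop (𝓝 a)) (hy : Tendsto ys atTop (𝓝 y)) :
    Tendsto (fun n => ∫ x in cell (as n) (ys n), h x) atTop (𝓝 (∫ x in cell a y, h x)) := by
  simp only [← integral_indicator (measurableSet_cell _ _)]
  refine tendsto_integral_of_dominated_convergence (fun x => ‖h x‖)
    (fun n => (hh.indicator (measurableSet_cell _ _)).aestronglyMeasurable) hh.norm
    (fun n => Eventually.of_forall fun x => norm_indicator_le_norm_self _ _) ?_
  -- Away from the limiting endpoints membership in the cell is eventually constant. For an infinite
  -- endpoint `toReal` merely discards the harmless point `0`.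
  filter_upwards [compl_mem_ae_iff.2 (measure_singleton (μ := volume) a.toReal),
    compl_mem_ae_iff.2 (measure_singleton (μ := volume) y.toReal)] with x hxa hxy
  have hxa' : (x : EReal) ≠ a := fun hc => hxa (by rw [← hc]; simp)
  have hxy' : (x : EReal) ≠ y := fun hc => hxy (by rw [← hc]; simp)
  have e1 : ∀ᶠ n in atTop, (as n ≤ x ↔ a ≤ x) := by
    rcases lt_or_gt_of_ne hxa' with h1 | h1
    · filter_upwards [ha.eventually_const_lt h1] with n hn
      exact iff_of_false (not_le.2 hn) (not_le.2 h1)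
    · filter_upwards [ha.eventually_lt_const h1] with n hn
      exact iff_of_true hn.le h1.le
  have e2 : ∀ᶠ n in atTop, ((x : EReal) < ys n ↔ (x : EReal) < y) := by
    rcases lt_or_gt_of_ne hxy' with h1 | h1
    · filter_upwards [hy.eventually_const_lt h1] with n hn
      exact iff_of_true hn h1
    · filter_upwards [hy.eventually_lt_const h1] with n hn
      exact iff_of_false (not_lt.2 hn.le) (not_lt.2 h1.le)
  refine tendsto_const_nhds.congr' ?_
  filter_upwards [e1, e2] with n h1 h2
  simp only [indicator, mem_cell, h1, h2]

lemma tendsto_centroid (hf : IsLogConcaveDensity f) {a y : EReal} {as ys : ℕ → EReal}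
    (ha : Tendsto as atTop (𝓝 a)) (hy : Tendsto ys atTop (𝓝 y)) (h : 0 < mass f a y) :
    Tendsto (fun n => centroid f (as n) (ys n)) atTop (𝓝 (centroid f a y)) :=
  (tendsto_setIntegral_cell hf.integrable_mul ha hy).div
    (tendsto_setIntegral_cell hf.isDensity.integrable ha hy) h.ne'

lemma tendsto_cellCost_centroid (hf : IsLogConcaveDensity f) {a y : EReal} {as ys : ℕ → EReal}
    (ha : Tendsto as atTop (𝓝 a)) (hy : Tendsto ys atTop (𝓝 y)) (h : 0 < mass f a y) :
    Tendsto (fun n => cellCost f (centroid f (as n) (ys n)) (as n) (ys n)) atTop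
      (𝓝 (cellCost f (centroid f a y) a y)) := by
  simp only [cellCost_eq hf]
  have h1 := tendsto_setIntegral_cell hf.integrable_sq_mul ha hy
  have h2 : Tendsto (fun n => moment f (as n) (ys n)) atTop (𝓝 (moment f a y)) :=
    tendsto_setIntegral_cell hf.integrable_mul ha hy
  have h3 : Tendsto (fun n => mass f (as n) (ys n)) atTop (𝓝 (mass f a y)) :=
    tendsto_setIntegral_cell hf.isDensity.integrable ha hy
  have h4 := tendsto_centroid hf ha hy h
  exact (h1.sub ((h4.const_mul 2).mul h2)).add ((h4.pow 2).mul h3)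

/-! ### Partitions of the real line and the bin-edge map -/

/-- The edges of a partition of the line into `N` cells; the `k`-th interior edge is `e k` for
`0 < k < N`, and the outer edges are `⊥` and `⊤`. -/
def edge (N : ℕ) (e : ℕ → ℝ) (k : ℕ) : EReal :=
  if k = 0 then ⊥ else if k < N then (e k : EReal) else ⊤

/-- `e` lists the interior edges of a partition of the support into `N` cells. -/
structure IsPartition (f : ℝ → ℝ) (N : ℕ) (e : ℕ → ℝ) : Prop where
  pos : 0 < N
  mem_core : ∀ k, k + 1 < N → e (k + 1) ∈ core f
  lt_succ : ∀ k, k + 2 < N → e (k + 1) < e (k + 2)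

/-- The centroid of the `k`-th cell. -/
def cellCentroid (f : ℝ → ℝ) (N : ℕ) (e : ℕ → ℝ) (k : ℕ) : ℝ :=
  centroid f (edge N e k) (edge N e (k + 1))

/-- The indifference points of an encoder with bias `b` if the decoder uses the centroids. -/
def edgeMap (f : ℝ → ℝ) (b : ℝ) (N : ℕ) (e : ℕ → ℝ) (k : ℕ) : ℝ :=
  (cellCentroid f N e (k - 1) + cellCentroid f N e k) / 2 + b

/-- A partition whose edges are the indifference points of the encoder. -/
structure IsStationary (f : ℝ → ℝ) (b : ℝ) (N : ℕ) (e : ℕ → ℝ) : Prop extends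
    IsPartition f N e where
  edgeMap_eq : ∀ k, k + 1 < N → edgeMap f b N e (k + 1) = e (k + 1)

/-- The quadratic distortion of a partition with centroid reconstruction. -/
def distortion (f : ℝ → ℝ) (N : ℕ) (e : ℕ → ℝ) : ℝ :=
  ∑ k ∈ Finset.range N, cellCost f (cellCentroid f N e k) (edge N e k) (edge N e (k + 1))

lemma edge_zero (N : ℕ) (e : ℕ → ℝ) : edge N e 0 = ⊥ := by simp [edge]

lemma edge_succ {N k : ℕ} (e : ℕ → ℝ) (h : k + 1 < N) : edge N e (k + 1) = e (k + 1) := by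
  simp [edge, h]

lemma edge_of_le {N k : ℕ} (e : ℕ → ℝ) (hN : 0 < N) (h : N ≤ k) : edge N e k = ⊤ := by
  simp [edge, show k ≠ 0 by omega, show ¬ k < N by omega]

lemma edge_mono {N : ℕ} {e e' : ℕ → ℝ} (h : ∀ k, k + 1 < N → e (k + 1) ≤ e' (k + 1)) (k : ℕ) :
    edge N e k ≤ edge N e' k := by
  rcases k with _ | k
  · simp [edge_zero]
  · by_cases hk : k + 1 < N
    · rw [edge_succ _ hk, edge_succ _ hk]; exact_mod_cast h k hk
    · simp [edge, hk]

lemma edge_congr {N : ℕ} {e e' : ℕ → ℝ} (h : ∀ k, k + 1 < N → e (k + 1) = e' (k + 1)) :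
    edge N e = edge N e' := funext fun k =>
  le_antisymm (edge_mono (fun k hk => (h k hk).le) k) (edge_mono (fun k hk => (h k hk).ge) k)

/-- Only the entries with index strictly between `0` and `N` matter; the others are junk values. -/
lemma distortion_congr {N : ℕ} {e e' : ℕ → ℝ} (h : ∀ k, k + 1 < N → e (k + 1) = e' (k + 1)) :
    distortion f N e = distortion f N e' := by
  simp only [distortion, cellCentroid, edge_congr h]

lemma edgeMap_succ (f : ℝ → ℝ) (b : ℝ) (N : ℕ) (e : ℕ → ℝ) (k : ℕ) :
    edgeMap f b N e (k + 1) = (cellCentroid f N e k + cellCentroid f N e (k + 1)) / 2 + b := rfl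

namespace IsPartition

variable {N : ℕ} {e : ℕ → ℝ}

lemma edge_lt_succ (h : IsPartition f N e) {k : ℕ} (hk : k < N) :
    edge N e k < edge N e (k + 1) := by
  rcases k with _ | k
  · rw [edge_zero]
    by_cases h1 : 0 + 1 < N
    · rw [edge_succ _ h1]; exact EReal.bot_lt_coe _
    · rw [edge_of_le _ h.pos (by omega)]; exact bot_lt_top
  · rw [edge_succ _ hk]
    by_cases h1 : k + 1 + 1 < N
    · rw [edge_succ _ h1]; exact_mod_cast h.lt_succ k h1
    · rw [edge_of_le _ h.pos (by omega)]; exact EReal.coe_lt_top _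

lemma mass_pos (h : IsPartition f N e) (hf : IsLogConcaveDensity f) {k : ℕ} (hk : k < N) :
    0 < mass f (edge N e k) (edge N e (k + 1)) := by
  have hlt := h.edge_lt_succ hk
  rcases k with _ | k
  · by_cases h1 : 0 + 1 < N
    · rw [edge_succ _ h1] at hlt ⊢
      exact mass_pos_of_right_mem hf (h.mem_core 0 h1) hlt
    · rw [edge_zero, edge_of_le _ h.pos (by omega)]; exact mass_bot_top_pos hf
  · rw [edge_succ _ hk] at hlt ⊢
    exact mass_pos_of_left_mem hf (h.mem_core k hk) hlt

lemma cellCentroid_lt (h : IsPartition f N e) (hf : IsLogConcaveDensity f) {k : ℕ}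
    (hk : k + 1 < N) : cellCentroid f N e k < e (k + 1) := by
  have := h.mass_pos hf (k := k) (by omega)
  rw [edge_succ _ hk] at this
  rw [cellCentroid, edge_succ _ hk]
  exact centroid_lt_right hf this

lemma lt_cellCentroid (h : IsPartition f N e) (hf : IsLogConcaveDensity f) {k : ℕ}
    (hk : k + 1 < N) : e (k + 1) < cellCentroid f N e (k + 1) := by
  have := h.mass_pos hf hk
  rw [edge_succ _ hk] at this
  rw [cellCentroid, edge_succ _ hk]
  exact left_lt_centroid hf this

lemma cellCentroid_lt_succ (h : IsPartition f N e) (hf : IsLogConcaveDensity f) {k : ℕ}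
    (hk : k + 1 < N) : cellCentroid f N e k < cellCentroid f N e (k + 1) :=
  (h.cellCentroid_lt hf hk).trans (h.lt_cellCentroid hf hk)

lemma edgeMap (h : IsPartition f N e) (hf : IsLogConcaveDensity f) (b : ℝ)
    (hc : ∀ k, k + 1 < N → edgeMap f b N e (k + 1) ∈ core f) :
    IsPartition f N (edgeMap f b N e) where
  pos := h.pos
  mem_core := hc
  lt_succ k hk := by
    have h1 := h.cellCentroid_lt_succ hf (k := k) (by omega)
    have h2 := h.cellCentroid_lt_succ hf (k := k + 1) (by omega)
    rw [edgeMap_succ, edgeMap_succ]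
    linarith

lemma cellCentroid_mono (h : IsPartition f N e) (hf : IsLogConcaveDensity f) {e' : ℕ → ℝ}
    (h' : IsPartition f N e') (hle : ∀ k, k + 1 < N → e (k + 1) ≤ e' (k + 1)) {k : ℕ}
    (hk : k < N) : cellCentroid f N e k ≤ cellCentroid f N e' k :=
  centroid_mono hf (h.mass_pos hf hk) (h'.mass_pos hf hk) (edge_mono hle k) (edge_mono hle _)

lemma edgeMap_mono (h : IsPartition f N e) (hf : IsLogConcaveDensity f) (b : ℝ) {e' : ℕ → ℝ}
    (h' : IsPartition f N e') (hle : ∀ k, k + 1 < N → e (k + 1) ≤ e' (k + 1)) {k : ℕ}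
    (hk : k + 1 < N) :
    CheapTalk.edgeMap f b N e (k + 1) ≤ CheapTalk.edgeMap f b N e' (k + 1) := by
  have h1 := h.cellCentroid_mono hf h' hle (k := k) (by omega)
  have h2 := h.cellCentroid_mono hf h' hle hk
  rw [edgeMap_succ, edgeMap_succ]
  linarith

end IsPartition

/-- Every point to the right of the midpoint is at least as close to `v` as to `u`. -/
lemma cellCost_le_of_mid_le (hf : IsLogConcaveDensity f) {u v : ℝ} {a y : EReal} (huv : u ≤ v)
    (h : ∀ x ∈ cell a y, (u + v) / 2 ≤ x) : cellCost f v a y ≤ cellCost f u a y := by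
  refine setIntegral_mono_on (hf.integrable_sub_sq_mul v).integrableOn
    (hf.integrable_sub_sq_mul u).integrableOn (measurableSet_cell _ _) fun x hx => ?_
  refine mul_le_mul_of_nonneg_right ?_ (hf.isDensity.nonneg x)
  nlinarith [h x hx]

/-- Moving edges to the left without crossing the midpoints of the centroids does not increase
the distortion: only points closer to the next centroid change their cell. -/
lemma distortion_le_of_mid_le (hf : IsLogConcaveDensity f) {N : ℕ} {e e' : ℕ → ℝ}
    (h : IsPartition f N e) (h' : IsPartition f N e')
    (hle : ∀ k, k + 1 < N → e' (k + 1) ≤ e (k + 1))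
    (hmid : ∀ k, k + 1 < N →
      (cellCentroid f N e k + cellCentroid f N e (k + 1)) / 2 ≤ e' (k + 1)) :
    distortion f N e' ≤ distortion f N e := by
  set c := cellCentroid f N e with hc
  have hedge := edge_mono hle
  -- No new edge reaches the preceding old edge: the old edge lies below its right centroid, hence
  -- below the next midpoint. So every point moves by at most one cell.
  have hinter : ∀ k, k < N → edge N e k ≤ edge N e' (k + 1) := by
    intro k hk
    rcases k with _ | k
    · rw [edge_zero]; exact bot_le
    · by_cases h1 : k + 1 + 1 < N
      · rw [edge_succ _ hk, edge_succ _ h1]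
        have h2 := hmid (k + 1) h1
        have h3 := h.lt_cellCentroid hf hk
        have h4 := h.cellCentroid_lt_succ hf h1
        rw [← hc] at h3 h4
        have : e (k + 1) ≤ e' (k + 1 + 1) := by linarith
        exact_mod_cast this
      · rw [edge_of_le e' h.pos (by omega)]; exact le_top
  -- Keeping the old centroids as representatives can only increase the cost of the new cells.
  have s1 : distortion f N e' ≤
      ∑ k ∈ Finset.range N, cellCost f (c k) (edge N e' k) (edge N e' (k + 1)) := by
    refine Finset.sum_le_sum fun k hk => ?_
    have hm := h'.mass_pos hf (Finset.mem_range.1 hk)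
    rw [cellCost_eq_centroid hf (c k) hm, cellCentroid]
    have := mul_nonneg hm.le (sq_nonneg (c k - centroid f (edge N e' k) (edge N e' (k + 1))))
    linarith
  refine s1.trans ?_
  have s2 : ∑ k ∈ Finset.range N, cellCost f (c k) (edge N e' k) (edge N e' (k + 1)) =
      ∑ k ∈ Finset.range N, cellCost f (c k) (edge N e' k) (edge N e k) +
      ∑ k ∈ Finset.range N, cellCost f (c k) (edge N e k) (edge N e' (k + 1)) := by
    rw [← Finset.sum_add_distrib]
    exact Finset.sum_congr rfl fun k hk =>
      cellCost_add hf _ (hedge k) (hinter k (Finset.mem_range.1 hk))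
  have s3 : distortion f N e =
      ∑ k ∈ Finset.range N, cellCost f (c k) (edge N e k) (edge N e' (k + 1)) +
      ∑ k ∈ Finset.range N, cellCost f (c k) (edge N e' (k + 1)) (edge N e (k + 1)) := by
    rw [distortion, ← Finset.sum_add_distrib]
    exact Finset.sum_congr rfl fun k hk =>
      cellCost_add hf _ (hinter k (Finset.mem_range.1 hk)) (hedge (k + 1))
  obtain ⟨n, rfl⟩ : ∃ n, N = n + 1 := ⟨N - 1, by have := h.pos; omega⟩
  -- The strip between a new and an old edge is charged to the right cell in the new partition and
  -- to the left cell in the old one. The indices match after a shift because the outer strips are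
  -- empty.
  have s4 : ∑ k ∈ Finset.range (n + 1), cellCost f (c k) (edge (n + 1) e' k) (edge (n + 1) e k) ≤
      ∑ k ∈ Finset.range (n + 1),
        cellCost f (c k) (edge (n + 1) e' (k + 1)) (edge (n + 1) e (k + 1)) := by
    rw [Finset.sum_range_succ', Finset.sum_range_succ, edge_zero, edge_zero, cellCost_self,
      edge_of_le e h.pos le_rfl, edge_of_le e' h.pos le_rfl, cellCost_self, add_zero, add_zero]
    refine Finset.sum_le_sum fun k hk => ?_
    have hk' : k + 1 < n + 1 := by have := Finset.mem_range.1 hk; omega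
    refine cellCost_le_of_mid_le hf (h.cellCentroid_lt_succ hf hk').le fun x hx => ?_
    refine (hmid k hk').trans ?_
    have := hx.1
    rw [edge_succ _ hk'] at this
    exact_mod_cast this
  rw [s2, s3]
  linarith

lemma tendsto_edge {N : ℕ} {E : ℕ → ℕ → ℝ} {F : ℕ → ℝ}
    (h : ∀ k, k + 1 < N → Tendsto (fun n => E n (k + 1)) atTop (𝓝 (F (k + 1)))) (k : ℕ) :
    Tendsto (fun n => edge N (E n) k) atTop (𝓝 (edge N F k)) := by
  rcases k with _ | k
  · simp only [edge_zero]; exact tendsto_const_nhds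
  · by_cases hk : k + 1 < N
    · simp only [edge_succ _ hk]
      exact (continuous_coe_real_ereal.tendsto _).comp (h k hk)
    · simp only [edge, hk]; exact tendsto_const_nhds

/-- Iterating the edge map from a supersolution above a subsolution leads to a stationary
partition. If the bias is nonnegative, the distortion decreases along the way. -/
theorem exists_isStationary_between (hf : IsLogConcaveDensity f) {b : ℝ} (hb : 0 ≤ b) {N : ℕ}
    {s e₀ : ℕ → ℝ} (hs : IsPartition f N s) (he : IsPartition f N e₀)
    (hse : ∀ k, k + 1 < N → s (k + 1) ≤ e₀ (k + 1))
    (hsub : ∀ k, k + 1 < N → s (k + 1) ≤ edgeMap f b N s (k + 1))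
    (hsup : ∀ k, k + 1 < N → edgeMap f b N e₀ (k + 1) ≤ e₀ (k + 1)) :
    ∃ e, IsStationary f b N e ∧ distortion f N e ≤ distortion f N e₀ := by
  set E : ℕ → ℕ → ℝ := fun n => (edgeMap f b N)^[n] e₀ with hE
  have hE0 : E 0 = e₀ := rfl
  have hEs : ∀ n, E (n + 1) = edgeMap f b N (E n) := fun n => Function.iterate_succ_apply' _ _ _
  have inv : ∀ n, IsPartition f N (E n) ∧ (∀ k, k + 1 < N → s (k + 1) ≤ E n (k + 1)) ∧
      (∀ k, k + 1 < N → E (n + 1) (k + 1) ≤ E n (k + 1)) ∧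
      (∀ k, k + 1 < N → E n (k + 1) ≤ e₀ (k + 1)) ∧ distortion f N (E n) ≤ distortion f N e₀ := by
    intro n
    induction n with
    | zero => exact ⟨he, hse, fun k hk => by rw [hEs]; exact hsup k hk, fun _ _ => le_rfl, le_rfl⟩
    | succ n ih =>
      obtain ⟨h1, h2, h3, h4, h5⟩ := ih
      have g2 : ∀ k, k + 1 < N → s (k + 1) ≤ E (n + 1) (k + 1) := fun k hk => by
        rw [hEs]; exact (hsub k hk).trans (hs.edgeMap_mono hf b h1 h2 hk)
      have g4 : ∀ k, k + 1 < N → E (n + 1) (k + 1) ≤ e₀ (k + 1) := fun k hk =>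
        (h3 k hk).trans (h4 k hk)
      have g1 : IsPartition f N (E (n + 1)) := by
        rw [hEs]
        refine h1.edgeMap hf b fun k hk => ?_
        rw [← hEs]
        exact hf.ordConnected_core.out (hs.mem_core k hk) (he.mem_core k hk) ⟨g2 k hk, g4 k hk⟩
      refine ⟨g1, g2, fun k hk => ?_, g4, ?_⟩
      · rw [hEs (n + 1)]
        conv_rhs => rw [hEs n]
        exact g1.edgeMap_mono hf b h1 h3 hk
      · refine (distortion_le_of_mid_le hf h1 g1 h3 fun k hk => ?_).trans h5
        rw [hEs, edgeMap_succ]; linarith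
  set F : ℕ → ℝ := fun k => ⨅ n, E n k with hF
  have hlim : ∀ k, k + 1 < N → Tendsto (fun n => E n (k + 1)) atTop (𝓝 (F (k + 1))) := by
    intro k hk
    refine tendsto_atTop_ciInf (antitone_nat_of_succ_le fun n => (inv n).2.2.1 k hk)
      ⟨s (k + 1), ?_⟩
    rintro _ ⟨n, rfl⟩
    exact (inv n).2.1 k hk
  have hedge := tendsto_edge hlim
  have hmem : ∀ k, k + 1 < N → F (k + 1) ∈ core f := fun k hk =>
    hf.ordConnected_core.out (hs.mem_core k hk) (he.mem_core k hk)
      ⟨ge_of_tendsto' (hlim k hk) fun n => (inv n).2.1 k hk,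
        le_of_tendsto' (hlim k hk) fun n => (inv n).2.2.2.1 k hk⟩
  -- Limiting edges might coalesce. Strictness is proved from left to right, since a cell already
  -- known to be nondegenerate has a convergent centroid.
  have hlt : ∀ k, k + 1 < N → edge N F k < edge N F (k + 1) := by
    intro k
    induction k with
    | zero => intro hk; rw [edge_zero, edge_succ _ hk]; exact EReal.bot_lt_coe _
    | succ k ih =>
      intro hk
      have hk' : k + 1 < N := by omega
      have h1 := ih hk'
      have h2 : 0 < mass f (edge N F k) (edge N F (k + 1)) := by
        rw [edge_succ _ hk'] at h1 ⊢
        exact mass_pos_of_right_mem hf (hmem k hk') h1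
      have h3 := tendsto_centroid hf (hedge k) (hedge (k + 1)) h2
      have h4 : centroid f (edge N F k) (edge N F (k + 1)) < F (k + 1) := by
        rw [edge_succ _ hk'] at h2 ⊢
        exact centroid_lt_right hf h2
      have h5 := ((hlim (k + 1) hk).comp (tendsto_add_atTop_nat 1)).sub
        ((hlim k hk').comp (tendsto_add_atTop_nat 1))
      -- One application of the map leaves a gap of half the distance between the centroids two
      -- cells apart, and the right one exceeds the old edge `E n (k + 2)`. In the limit the gap is
      -- at least `F (k + 1)` minus the centroid of the cell on its left, which is positive.
      have h6 := ((hlim (k + 1) hk).sub h3).div_const 2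
      have h7 := le_of_tendsto_of_tendsto' h6 h5 fun n => by
        have g := (inv n).1.lt_cellCentroid hf hk
        simp only [Function.comp_apply, hEs, edgeMap_succ]
        have : cellCentroid f N (E n) k = centroid f (edge N (E n) k) (edge N (E n) (k + 1)) := rfl
        rw [← this]
        linarith
      rw [edge_succ _ hk', edge_succ _ hk]
      have : F (k + 1) < F (k + 1 + 1) := by linarith
      exact_mod_cast this
  have hpart : IsPartition f N F := ⟨he.pos, hmem, fun k hk => by
    have := hlt (k + 1) (by omega)
    rw [edge_succ _ hk, edge_succ _ (by omega)] at this
    exact_mod_cast this⟩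
  refine ⟨F, ⟨hpart, fun k hk => ?_⟩, ?_⟩
  · have h1 := tendsto_centroid hf (hedge k) (hedge (k + 1)) (hpart.mass_pos hf (by omega))
    have h2 := tendsto_centroid hf (hedge (k + 1)) (hedge (k + 2)) (hpart.mass_pos hf hk)
    have h3 := ((h1.add h2).div_const 2).add_const b
    refine tendsto_nhds_unique h3 (((hlim k hk).comp (tendsto_add_atTop_nat 1)).congr fun n => ?_)
    simp only [Function.comp_apply, hEs, edgeMap_succ]
    rfl
  · have hD : Tendsto (fun n => distortion f N (E n)) atTop (𝓝 (distortion f N F)) :=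
      tendsto_finsetSum _ fun k hk => tendsto_cellCost_centroid hf (hedge k) (hedge (k + 1))
      (hpart.mass_pos hf (Finset.mem_range.1 hk))
    exact le_of_tendsto' hD fun n => (inv n).2.2.2.2

/-! ### Comparison of stationary partitions -/

/-- Taking the last maximiser makes the comparison at the next edge strict. -/
lemma exists_last_max (d : ℕ → ℝ) {n : ℕ} (hn : 0 < n) :
    ∃ k < n, (∀ j < n, d j ≤ d k) ∧ ∀ j < n, k < j → d j < d k := by
  induction n with
  | zero => omega
  | succ n ih =>
    rcases Nat.eq_zero_or_pos n with rfl | h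
    · refine ⟨0, one_pos, fun j hj => ?_, fun j hj h0 => by omega⟩
      rw [show j = 0 by omega]
    · obtain ⟨k, hk, h1, h2⟩ := ih h
      rcases le_or_gt (d k) (d n) with h3 | h3
      · refine ⟨n, by omega, fun j hj => ?_, fun j hj h0 => by omega⟩
        rcases Nat.lt_succ_iff_lt_or_eq.1 hj with h4 | rfl
        · exact (h1 j h4).trans h3
        · exact le_rfl
      · refine ⟨k, by omega, fun j hj => ?_, fun j hj h0 => ?_⟩ <;>
          rcases Nat.lt_succ_iff_lt_or_eq.1 hj with h4 | rfl
        · exact h1 j h4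
        · exact h3.le
        · exact h2 j h4 h0
        · exact h3

/-- Beyond the interior edges of the coarser partition its edge is `⊤`, so extra cells of the finer
one cost nothing. -/
lemma edge_le_edge_add {K N : ℕ} (hK : 0 < K) (hKN : K ≤ N) {e e' : ℕ → ℝ} {t : ℝ}
    (h : ∀ j, j + 1 < K → e' (j + 1) ≤ e (j + 1) + t) (k : ℕ) :
    edge N e' k ≤ edge K e k + t := by
  rcases k with _ | k
  · rw [edge_zero]; exact bot_le
  · by_cases hk : k + 1 < K
    · rw [edge_succ _ hk, edge_succ _ (by omega)]; exact_mod_cast h k hk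
    · rw [edge_of_le e hK (by omega), EReal.top_add_coe]; exact le_top

lemma edge_anti_count {K N : ℕ} (hK : 0 < K) (hKN : K ≤ N) (e : ℕ → ℝ) (k : ℕ) :
    edge N e k ≤ edge K e k := by
  have := edge_le_edge_add hK hKN (e := e) (e' := e) (t := 0) (fun j _ => by simp) k
  simpa using this

lemma edge_add_coe {N k : ℕ} (e : ℕ → ℝ) (hk : k + 1 < N) (t : ℝ) :
    edge N e (k + 1) + t = ((e (k + 1) + t : ℝ) : EReal) := by
  rw [edge_succ _ hk, EReal.coe_add]

lemma add_coe_lt_add_coe {p q : EReal} (h : p < q) (t : ℝ) : p + t < q + t :=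
  EReal.add_lt_add_right_coe h t

/-- The edges of a stationary partition with more cells lie further to the left. -/
theorem IsStationary.le_of_lt (hf : IsLogConcaveDensity f) {b : ℝ} {K N : ℕ} {m m' : ℕ → ℝ}
    (h : IsStationary f b K m) (h' : IsStationary f b N m') (hKN : K < N) :
    ∀ k, k + 1 < K → m' (k + 1) ≤ m (k + 1) := by
  by_contra! hc
  obtain ⟨i, hi, hlt⟩ := hc
  obtain ⟨k, hk, hmax, hlast⟩ := exists_last_max (fun j => m' (j + 1) - m (j + 1))
    (n := K - 1) (by omega)
  set t := m' (k + 1) - m (k + 1) with ht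
  have htpos : 0 < t := lt_of_lt_of_le (sub_pos.2 hlt) (hmax i (by omega))
  have hedge : ∀ j, edge N m' j ≤ edge K m j + t := edge_le_edge_add h.pos hKN.le fun j hj => by
    have : m' (j + 1) - m (j + 1) ≤ t := hmax j (by omega)
    linarith
  have hk1 : k + 1 < K := by omega
  have e1 : edge K m (k + 1) + t = (m' (k + 1) : EReal) := by
    rw [edge_add_coe m hk1, ht]; congr 1; ring
  -- If `k + 2 = K`, strictness comes from `K < N`: the edge of `m'` is finite while that of `m` is
  -- `⊤`.
  have hlt2 : (m' (k + 2) : EReal) < edge K m (k + 2) + t := by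
    by_cases hk2 : k + 2 < K
    · rw [edge_add_coe m hk2]
      have : m' (k + 2) - m (k + 2) < t := hlast (k + 1) (by omega) (by omega)
      have : m' (k + 2) < m (k + 2) + t := by linarith
      exact_mod_cast this
    · rw [edge_of_le m h.pos (by omega), EReal.top_add_coe]; exact EReal.coe_lt_top _
  have c1 : cellCentroid f N m' k ≤ cellCentroid f K m k + t := by
    refine centroid_le_add hf htpos.le (h.mass_pos hf (by omega)) ?_ (h'.mass_pos hf (by omega))
      (hedge _) (hedge _)
    have := add_coe_lt_add_coe (h.edge_lt_succ (k := k) (by omega)) t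
    rw [e1] at this ⊢
    exact mass_pos_of_right_mem hf (h'.mem_core k (by omega)) this
  have c2 : cellCentroid f N m' (k + 1) < cellCentroid f K m (k + 1) + t := by
    have hp := h'.mass_pos hf (k := k + 1) (by omega)
    have hs := add_coe_lt_add_coe (h.edge_lt_succ (k := k + 1) (by omega)) t
    have hm := h.mass_pos hf (k := k + 1) (by omega)
    have hs' : 0 < mass f (edge K m (k + 1) + t) (edge K m (k + 2) + t) := by
      rw [e1] at hs ⊢
      exact mass_pos_of_left_mem hf (h'.mem_core k (by omega)) hs
    refine lt_of_lt_of_le ?_ (centroid_shift_le hf htpos.le hm hs')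
    rw [cellCentroid, edge_succ m' (show k + 1 + 1 < N by omega),
      edge_succ m' (show k + 1 < N by omega)] at *
    rw [e1]
    exact centroid_lt_centroid_right hf hp (le_of_mass_pos hp)
      (mass_pos_of_left_mem hf (h'.mem_core (k + 1) (by omega)) hlt2) hlt2.le
  -- Averaging the two centroid bounds gives `m' (k + 1) < m (k + 1) + t`, against the choice of
  -- `t`.
  have q1 := h.edgeMap_eq k hk1
  have q2 := h'.edgeMap_eq k (by omega)
  rw [edgeMap_succ] at q1 q2
  linarith

/-! ### Splitting the last cell. -/

lemma setIntegral_cell_top_eq (hf : IsLogConcaveDensity f) {g : ℝ → ℝ}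
    (hg : Integrable (fun x => g x * f x)) {a : EReal} {y : ℝ} (hay : a ≤ y)
    (hy : ∀ x ∈ core f, x < y) :
    ∫ x in cell a ⊤, g x * f x = ∫ x in cell a y, g x * f x := by
  rw [setIntegral_cell_add hg hay le_top]
  have : ∫ x in cell y ⊤, g x * f x = 0 := by
    rw [setIntegral_congr_ae (g := fun _ => (0 : ℝ)) (measurableSet_cell _ _)]
    · simp
    · filter_upwards [hf.ae_mem_core] with x hx hxc
      by_contra hne
      have h1 := hy x (hx (right_ne_zero_of_mul hne))
      exact absurd hxc.1 (not_le.2 (by exact_mod_cast h1))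
  rw [this, add_zero]

lemma mass_top_eq (hf : IsLogConcaveDensity f) {a : EReal} {y : ℝ} (hay : a ≤ y)
    (hy : ∀ x ∈ core f, x < y) : mass f a ⊤ = mass f a y := by
  have := setIntegral_cell_top_eq hf (g := fun _ => 1) (by simpa using hf.isDensity.integrable)
    hay hy
  simpa [mass] using this

lemma centroid_top_eq (hf : IsLogConcaveDensity f) {a : EReal} {y : ℝ} (hay : a ≤ y)
    (hy : ∀ x ∈ core f, x < y) : centroid f a ⊤ = centroid f a y := by
  rw [centroid, centroid, mass_top_eq hf hay hy, moment, moment,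
    setIntegral_cell_top_eq hf hf.integrable_mul hay hy]

lemma exists_mem_Ioo_of_ae {p : ℝ → Prop} (hp : ∀ᵐ x, p x) {a y : ℝ} (h : a < y) :
    ∃ x ∈ Ioo a y, p x := by
  obtain ⟨x, hx, h1⟩ := (Measure.dense_of_ae hp).exists_between h
  exact ⟨x, h1, hx⟩

/-- The shift inequality for centroids is strict if the shifted cell leaves the support. -/
lemma centroid_shift_lt_of_exceeds (hf : IsLogConcaveDensity f) {a y z t : ℝ} (ht : 0 ≤ t)
    (ha : a ∈ core f) (hy : y ∈ core f) (hay : a < y) (hat : a + t ∈ core f) (hzy : z < y)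
    (hz : ∀ x ∈ core f, x < z + t) : centroid f ((a + t : ℝ) : EReal) ⊤ < centroid f a y + t := by
  have hyt : ∀ x ∈ core f, x < y + t := fun x hx => (hz x hx).trans (by linarith)
  have hlt : (a : EReal) < y := by exact_mod_cast hay
  have hlt' : ((a + t : ℝ) : EReal) < ((y + t : ℝ) : EReal) := by
    exact_mod_cast (show a + t < y + t by linarith)
  have hm := mass_pos_of_left_mem hf ha hlt
  have hm' := mass_pos_of_left_mem hf hat hlt'
  rw [centroid_top_eq hf hlt'.le hyt]
  rw [EReal.coe_add, EReal.coe_add] at *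
  refine lt_of_le_of_ne (centroid_shift_le hf ht hm hm') fun heq => ?_
  obtain ⟨r, hr⟩ := ae_eq_of_centroid_shift_eq hf ht hm hm' heq
  -- For `x` in the cell beyond `z` the point `x + t` has left the support although `f x` is
  -- positive, so the proportionality factor vanishes. The whole shifted cell would then be null.
  have hr0 : r = 0 := by
    have hmax : max a z < y := max_lt hay hzy
    obtain ⟨x, hx, hx1⟩ := exists_mem_Ioo_of_ae hr hmax
    obtain ⟨hax, hzx⟩ := max_lt_iff.1 hx.1
    have h1 := hx1 ⟨by exact_mod_cast hax.le, by exact_mod_cast hx.2⟩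
    have h2 : f (x + t) = 0 := by
      by_contra hne
      have h3 := hz a ha
      have h4 := hf.mem_core_of_lt_of_lt (y := (z + x) / 2 + t) (core_subset_support ha) hne
        (by linarith) (by linarith)
      linarith [hz _ h4]
    rw [h2] at h1
    have h5 := hf.ordConnected_core.out ha hy ⟨hax.le, hx.2.le⟩
    exact (mul_eq_zero.1 h1.symm).resolve_right (hf.pos_of_mem_core h5).ne'
  rw [mass, setIntegral_cell_shift, setIntegral_congr_ae (g := fun _ => (0 : ℝ))
    (measurableSet_cell _ _)] at hm'
  · simp at hm'
  · filter_upwards [hr] with x hx hxc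
    rw [hx hxc, hr0, zero_mul]

lemma lt_csSup_core (hbd : BddAbove (core f)) : ∀ x ∈ core f, x < sSup (core f) := fun x hx => by
  obtain ⟨y, hy, hyc⟩ := exists_gt_mem_core hx
  exact lt_of_lt_of_le hy (le_csSup hbd hyc)

/-- If there is a stationary partition with more cells and the support is bounded above, then the
last cell of a stationary partition is long enough to be split. -/
theorem IsStationary.last_centroid_lt (hf : IsLogConcaveDensity f) {b : ℝ} {L N : ℕ}
    {m m' : ℕ → ℝ} (h : IsStationary f b (L + 1) m) (h' : IsStationary f b N m') (hLN : L + 1 < N)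
    (hbd : BddAbove (core f)) : cellCentroid f (L + 1) m L + 2 * b < sSup (core f) := by
  set U := sSup (core f) with hU
  have hUlt := lt_csSup_core hbd
  by_contra! hc
  set w := cellCentroid f (L + 1) m L + 2 * b with hw
  -- The fictitious extra edge `w` solves `w = (c + w) / 2 + b`, with `c` the last centroid of `m`:
  -- it is the indifference point for a degenerate next cell concentrated at `w`. If `w` reached the
  -- end `U` of the support, the maximum principle would apply to the extended list of edges.
  set mh : ℕ → ℝ := fun j => if j < L + 1 then m j else w with hmh
  have mh1 : ∀ j, j < L → mh (j + 1) = m (j + 1) := fun j hj => by simp [hmh, hj]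
  have mh2 : mh (L + 1) = w := by simp [hmh]
  obtain ⟨k, hk, hmax, hlast⟩ := exists_last_max (fun j => mh (j + 1) - m' (j + 1))
    (n := L + 1) (by omega)
  set t := mh (k + 1) - m' (k + 1) with ht
  have htpos : 0 < t := by
    refine lt_of_lt_of_le ?_ (hmax L (by omega))
    simp only [mh2]
    linarith [hUlt _ (h'.mem_core L hLN)]
  have hle : ∀ j, j < L → m (j + 1) ≤ m' (j + 1) + t := fun j hj => by
    have : mh (j + 1) - m' (j + 1) ≤ t := hmax j (by omega)
    rw [mh1 j hj] at this; linarith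
  have hedge : ∀ j, j ≤ L → edge (L + 1) m j ≤ edge N m' j + t := by
    intro j hj
    rcases j with _ | j
    · rw [edge_zero]; exact bot_le
    · rw [edge_succ m (by omega), edge_add_coe m' (by omega)]
      exact_mod_cast hle j (by omega)
  have q2 := h'.edgeMap_eq k (by omega)
  rw [edgeMap_succ] at q2
  rcases Nat.lt_succ_iff_lt_or_eq.1 hk with hkL | rfl
  · have hmk : m (k + 1) = m' (k + 1) + t := by rw [ht, mh1 k hkL]; ring
    have e1 : edge N m' (k + 1) + t = (m (k + 1) : EReal) := by
      rw [edge_add_coe m' (by omega), hmk]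
    have c1 : cellCentroid f (L + 1) m k ≤ cellCentroid f N m' k + t := by
      refine centroid_le_add hf htpos.le (h'.mass_pos hf (by omega)) ?_ (h.mass_pos hf (by omega))
        (hedge _ (by omega)) (hedge _ (by omega))
      have := add_coe_lt_add_coe (h'.edge_lt_succ (k := k) (by omega)) t
      rw [e1] at this ⊢
      exact mass_pos_of_right_mem hf (h.mem_core k (by omega)) this
    have c2 : cellCentroid f (L + 1) m (k + 1) < cellCentroid f N m' (k + 1) + t := by
      have hmc := h.mem_core k (by omega)
      by_cases hk2 : k + 2 < L + 1
      · have hp := h.mass_pos hf (k := k + 1) (by omega)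
        have hs := add_coe_lt_add_coe (h'.edge_lt_succ (k := k + 1) (by omega)) t
        have hm := h'.mass_pos hf (k := k + 1) (by omega)
        have hs' : 0 < mass f (edge N m' (k + 1) + t) (edge N m' (k + 2) + t) := by
          rw [e1] at hs ⊢
          exact mass_pos_of_left_mem hf hmc hs
        have hlt2 : (m (k + 2) : EReal) < edge N m' (k + 2) + t := by
          rw [edge_add_coe m' (by omega)]
          have : mh (k + 1 + 1) - m' (k + 1 + 1) < t := hlast (k + 1) (by omega) (by omega)
          rw [mh1 _ (by omega)] at this
          exact_mod_cast (show m (k + 1 + 1) < m' (k + 1 + 1) + t by linarith)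
        refine lt_of_lt_of_le ?_ (centroid_shift_le hf htpos.le hm hs')
        rw [cellCentroid, edge_succ m (show k + 1 + 1 < L + 1 by omega),
          edge_succ m (show k + 1 < L + 1 by omega)] at *
        rw [e1]
        exact centroid_lt_centroid_right hf hp (le_of_mass_pos hp)
          (mass_pos_of_left_mem hf (h.mem_core (k + 1) (by omega)) hlt2) hlt2.le
      · obtain rfl : k + 1 = L := by omega
        have h3 : mh (k + 1 + 1) - m' (k + 1 + 1) < t := hlast (k + 1) (by omega) (by omega)
        rw [mh2] at h3
        rw [cellCentroid, cellCentroid, edge_of_le m h.pos le_rfl, edge_succ m (by omega),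
          edge_succ m' (by omega), edge_succ m' hLN, hmk]
        rw [hmk] at hmc
        -- Maximality of `t` at the last index `k` gives `U ≤ w < m' (k + 2) + t`, so the shifted
        -- cell overshoots the support.
        exact centroid_shift_lt_of_exceeds hf (z := U - t) htpos.le (h'.mem_core k (by omega))
          (h'.mem_core (k + 1) hLN) (h'.lt_succ k (by omega)) hmc (by linarith)
          (fun x hx => by linarith [hUlt x hx])
    have q1 := h.edgeMap_eq k (by omega)
    rw [edgeMap_succ] at q1
    linarith
  · have hwk : w = m' (k + 1) + t := by rw [ht, mh2]; ring
    have hwU : ∀ x ∈ core f, x < w := fun x hx => (hUlt x hx).trans_le hc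
    have c3 := h'.lt_cellCentroid hf hLN
    have hck := centroid_mem_core hf (h.mass_pos hf (k := k) (by omega))
    have hm := h.mass_pos hf (k := k) (by omega)
    have hm' := h'.mass_pos hf (k := k) (by omega)
    -- Given this bound, `w ≤ cellCentroid f N m' k + t + 2 * b`. This is less than `m' (k + 1) + t
    -- = w`, because the next centroid of `m'` exceeds `m' (k + 1)`.
    have key : cellCentroid f (k + 1) m k ≤ cellCentroid f N m' k + t := by
      by_cases hex : ∃ x ∈ core f, edge N m' k + t ≤ (x : EReal)
      · obtain ⟨x, hx, hxe⟩ := hex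
        have hew : edge (k + 1) m k ≤ (w : EReal) :=
          (hedge k le_rfl).trans (hxe.trans (by exact_mod_cast (hwU x hx).le))
        have e2 : edge N m' (k + 1) + t = (w : EReal) := by
          rw [edge_add_coe m' hLN, hwk]
        have e3 : edge (k + 1) m (k + 1) = ⊤ := edge_of_le m h.pos le_rfl
        rw [e3, mass_top_eq hf hew hwU] at hm
        rw [cellCentroid, e3, centroid_top_eq hf hew hwU]
        refine centroid_le_add hf htpos.le hm' ?_ hm (hedge k le_rfl) e2.ge
        rw [e2]
        exact CheapTalk.mass_pos hf hx hxe (by exact_mod_cast hwU x hx)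
      -- The shifted cell lies entirely to the right of the core, and so does its left edge, which
      -- is therefore above the centroid of `m`.
      · push Not at hex
        have h1 := hex _ hck
        rcases k with _ | k
        · simp [edge_zero] at h1
        · rw [edge_add_coe m' (by omega)] at h1
          have h2 := h'.lt_cellCentroid hf (k := k) (by omega)
          have h3 : centroid f (edge (k + 1 + 1) m (k + 1)) (edge (k + 1 + 1) m (k + 1 + 1)) <
            m' (k + 1) + t := by exact_mod_cast h1
          rw [cellCentroid]
          linarith
    linarith

/-- A point near the upper end of the support at which the last cell of a stationary partition can
be split, leaving the new edge to the right of its indifference point. -/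
lemma IsStationary.exists_split_point (hf : IsLogConcaveDensity f) {b : ℝ} {L N : ℕ}
    {m m' : ℕ → ℝ} (h : IsStationary f b (L + 1) m) (h' : IsStationary f b N m')
    (hLN : L + 1 < N) : ∃ y ∈ core f, edge (L + 1) m L < (y : EReal) ∧ m' (L + 1) ≤ y ∧
      (centroid f (edge (L + 1) m L) y + centroid f y ⊤) / 2 + b ≤ y := by
  obtain ⟨q, hq, hqe⟩ : ∃ q ∈ core f, edge (L + 1) m L < (q : EReal) := by
    rcases L with _ | L
    · obtain ⟨q, hq⟩ := hf.core_nonempty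
      exact ⟨q, hq, by rw [edge_zero]; exact EReal.bot_lt_coe q⟩
    · obtain ⟨q, hq, hqc⟩ := exists_gt_mem_core (h.mem_core L (by omega))
      exact ⟨q, hqc, by rw [edge_succ _ (by omega)]; exact_mod_cast hq⟩
  have hm'c := h'.mem_core L hLN
  set c := cellCentroid f (L + 1) m L with hc
  have hleft : ∀ y : ℝ, y ∈ core f → q ≤ y → edge (L + 1) m L < (y : EReal) ∧
      centroid f (edge (L + 1) m L) y ≤ c := fun y hy hqy => by
    have h1 : edge (L + 1) m L < (y : EReal) := hqe.trans_le (by exact_mod_cast hqy)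
    refine ⟨h1, ?_⟩
    rw [hc, cellCentroid, edge_of_le m h.pos le_rfl]
    exact centroid_mono_right hf (mass_pos_of_right_mem hf hy h1) h1.le le_top
  by_cases hbd : BddAbove (core f)
  · have hUlt := lt_csSup_core hbd
    have hlast := h.last_centroid_lt hf h' hLN hbd
    set U := sSup (core f) with hU
    -- The centroid to the right of `y` is below `U` and the one to the left is at most `c`, so `(c
    -- + U) / 2 + b` bounds the indifference point; `last_centroid_lt` places it below `U`.
    set y := max (max q (m' (L + 1))) ((c + U) / 2 + b) with hy
    have hyU : y < U := max_lt (max_lt (hUlt q hq) (hUlt _ hm'c)) (by linarith)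
    have hqy : q ≤ y := (le_max_left _ _).trans (le_max_left _ _)
    obtain ⟨p, hp, hyp⟩ := exists_lt_of_lt_csSup hf.core_nonempty hyU
    have hyc : y ∈ core f := hf.ordConnected_core.out hq hp ⟨hqy, hyp.le⟩
    obtain ⟨h1, h2⟩ := hleft y hyc hqy
    refine ⟨y, hyc, h1, (le_max_right _ _).trans (le_max_left _ _), ?_⟩
    have h3 := hUlt _ (centroid_mem_core hf (mass_pos_of_left_mem hf hyc (EReal.coe_lt_top y)))
    have h4 : (c + U) / 2 + b ≤ y := le_max_right _ _
    linarith
  · set y := max (max q (m' (L + 1))) (c + centroid f q ⊤ - q + 2 * b) with hy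
    have hqy : q ≤ y := (le_max_left _ _).trans (le_max_left _ _)
    obtain ⟨p, hp, hyp⟩ := not_bddAbove_iff.1 hbd y
    have hyc : y ∈ core f := hf.ordConnected_core.out hq hp ⟨hqy, hyp.le⟩
    obtain ⟨h1, h2⟩ := hleft y hyc hqy
    refine ⟨y, hyc, h1, (le_max_right _ _).trans (le_max_left _ _), ?_⟩
    have e1 : (q : EReal) + ((y - q : ℝ) : EReal) = y := by
      rw [← EReal.coe_add]; congr 1; ring
    have e2 : (⊤ : EReal) + ((y - q : ℝ) : EReal) = ⊤ := EReal.top_add_coe _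
    have h3 := centroid_shift_le hf (t := y - q) (by linarith)
      (mass_pos_of_left_mem hf hq (EReal.coe_lt_top q))
      (by rw [e1, e2]; exact mass_pos_of_left_mem hf hyc (EReal.coe_lt_top y))
    rw [e1, e2] at h3
    have h4 : c + centroid f q ⊤ - q + 2 * b ≤ y := le_max_right _ _
    linarith

/-- Splitting the last cell and relaxing the edges yields a stationary partition with one more cell
and strictly smaller distortion. -/
theorem IsStationary.exists_succ (hf : IsLogConcaveDensity f) {b : ℝ} (hb : 0 ≤ b) {K N : ℕ}
    {m m' : ℕ → ℝ} (h : IsStationary f b K m) (h' : IsStationary f b N m') (hKN : K < N) :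
    ∃ e, IsStationary f b (K + 1) e ∧ distortion f (K + 1) e < distortion f K m := by
  obtain ⟨L, rfl⟩ : ∃ L, K = L + 1 := ⟨K - 1, by have := h.pos; omega⟩
  obtain ⟨y, hyc, hLy, hm'y, hsplit⟩ := h.exists_split_point hf h' hKN
  set e₀ : ℕ → ℝ := fun j => if j < L + 1 then m j else y with he₀
  have e01 : ∀ j, j < L → e₀ (j + 1) = m (j + 1) := fun j hj => by simp [he₀, hj]
  have e02 : e₀ (L + 1) = y := by simp [he₀]
  have edge1 : ∀ j, j ≤ L → edge (L + 1 + 1) e₀ j = edge (L + 1) m j := by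
    intro j hj
    rcases j with _ | j
    · simp [edge_zero]
    · rw [edge_succ _ (by omega), edge_succ _ (by omega), e01 j (by omega)]
  have edge2 : edge (L + 1 + 1) e₀ (L + 1) = y := by rw [edge_succ _ (by omega), e02]
  have edge3 : edge (L + 1 + 1) e₀ (L + 1 + 1) = ⊤ := edge_of_le _ (by omega) le_rfl
  have edge4 : edge (L + 1) m (L + 1) = ⊤ := edge_of_le _ (by omega) le_rfl
  have part0 : IsPartition f (L + 1 + 1) e₀ := by
    refine ⟨by omega, fun k hk => ?_, fun k hk => ?_⟩
    · rcases Nat.lt_succ_iff_lt_or_eq.1 (show k < L + 1 by omega) with h1 | rfl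
      · rw [e01 k h1]; exact h.mem_core k (by omega)
      · rw [e02]; exact hyc
    · rcases Nat.lt_succ_iff_lt_or_eq.1 (show k + 1 < L + 1 by omega) with h1 | rfl
      · rw [e01 k (by omega), e01 (k + 1) h1]; exact h.lt_succ k (by omega)
      · rw [e01 k (by omega), e02]
        rw [edge_succ _ (by omega)] at hLy
        exact_mod_cast hLy
  have parts : IsPartition f (L + 1 + 1) m' :=
    ⟨by omega, fun k hk => h'.mem_core k (by omega), fun k hk => h'.lt_succ k (by omega)⟩
  have hcmp := h.le_of_lt hf h' hKN
  have hse : ∀ k, k + 1 < L + 1 + 1 → m' (k + 1) ≤ e₀ (k + 1) := fun k hk => by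
    rcases Nat.lt_succ_iff_lt_or_eq.1 (show k < L + 1 by omega) with h1 | rfl
    · rw [e01 k h1]; exact hcmp k (by omega)
    · rw [e02]; exact hm'y
  -- Dropping the later edges of `m'` extends the last cell kept to `⊤`, which can only raise the
  -- centroids.
  have hsub : ∀ k, k + 1 < L + 1 + 1 → m' (k + 1) ≤ edgeMap f b (L + 1 + 1) m' (k + 1) := by
    intro k hk
    have hcc : ∀ j, j < L + 1 + 1 → cellCentroid f N m' j ≤ cellCentroid f (L + 1 + 1) m' j :=
      fun j hj => centroid_mono hf (h'.mass_pos hf (by omega)) (parts.mass_pos hf hj)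
        (edge_anti_count (by omega) (by omega) m' _) (edge_anti_count (by omega) (by omega) m' _)
    rw [← h'.edgeMap_eq k (by omega), edgeMap_succ, edgeMap_succ]
    linarith [hcc k (by omega), hcc (k + 1) (by omega)]
  -- At an old edge the split only lowers the centroid of the truncated cell; at the new edge this
  -- is the choice of `y`.
  have hsup : ∀ k, k + 1 < L + 1 + 1 → edgeMap f b (L + 1 + 1) e₀ (k + 1) ≤ e₀ (k + 1) := by
    intro k hk
    rcases Nat.lt_succ_iff_lt_or_eq.1 (show k < L + 1 by omega) with h1 | rfl
    · have hed : ∀ j, j ≤ L + 1 → edge (L + 1 + 1) e₀ j ≤ edge (L + 1) m j := fun j hj => by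
        rcases Nat.le_succ_iff.1 hj with h2 | rfl
        · exact (edge1 j h2).le
        · rw [edge4]; exact le_top
      have hcc : ∀ j, j < L + 1 → cellCentroid f (L + 1 + 1) e₀ j ≤ cellCentroid f (L + 1) m j :=
        fun j hj => centroid_mono hf (part0.mass_pos hf (by omega)) (h.mass_pos hf hj)
          (hed _ (by omega)) (hed _ (by omega))
      rw [e01 k h1, ← h.edgeMap_eq k (by omega), edgeMap_succ, edgeMap_succ]
      linarith [hcc k (by omega), hcc (k + 1) (by omega)]
    · rw [edgeMap_succ, e02, cellCentroid, cellCentroid, edge1 k le_rfl, edge2, edge3]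
      exact hsplit
  obtain ⟨e, he, hde⟩ := exists_isStationary_between hf hb parts part0 hse hsub hsup
  refine ⟨e, he, hde.trans_lt ?_⟩
  rw [distortion, distortion, Finset.sum_range_succ, Finset.sum_range_succ, Finset.sum_range_succ]
  have s1 : ∑ k ∈ Finset.range L, cellCost f (cellCentroid f (L + 1 + 1) e₀ k)
        (edge (L + 1 + 1) e₀ k) (edge (L + 1 + 1) e₀ (k + 1)) =
      ∑ k ∈ Finset.range L, cellCost f (cellCentroid f (L + 1) m k)
        (edge (L + 1) m k) (edge (L + 1) m (k + 1)) := by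
    refine Finset.sum_congr rfl fun k hk => ?_
    have := Finset.mem_range.1 hk
    rw [cellCentroid, cellCentroid, edge1 k (by omega), edge1 (k + 1) (by omega)]
  rw [s1]
  have m1 := part0.mass_pos hf (k := L) (by omega)
  have m2 := part0.mass_pos hf (k := L + 1) (by omega)
  simp only [cellCentroid, edge1 L le_rfl, edge2, edge3, edge4] at m1 m2 ⊢
  set a := edge (L + 1) m L
  have d1 := cellCost_add hf (centroid f a ⊤) hLy.le le_top
  rw [cellCost_eq_centroid hf _ m1, cellCost_eq_centroid hf _ m2] at d1
  have d2 := centroid_lt_centroid_right hf m1 hLy.le m2 le_top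
  have d3 : 0 < mass f a y * (centroid f a ⊤ - centroid f a y) ^ 2 :=
    mul_pos m1 (pow_pos (by linarith) 2)
  have d4 := mul_nonneg m2.le (sq_nonneg (centroid f a ⊤ - centroid f y ⊤))
  linarith

/-! ### Uniqueness of stationary partitions -/

lemma exists_mem_cell_edge {N : ℕ} (hN : 0 < N) (e : ℕ → ℝ) (x : ℝ) :
    ∃ i < N, x ∈ cell (edge N e i) (edge N e (i + 1)) := by
  classical
  have hex : ∃ j, (x : EReal) < edge N e j :=
    ⟨N, by rw [edge_of_le e hN le_rfl]; exact EReal.coe_lt_top x⟩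
  have h1 := Nat.find_spec hex
  have h0 : Nat.find hex ≠ 0 := fun h0 => by rw [h0, edge_zero] at h1; simp at h1
  obtain ⟨i, hi⟩ := Nat.exists_eq_succ_of_ne_zero h0
  have hle : Nat.find hex ≤ N :=
    Nat.find_min' hex (by rw [edge_of_le e hN le_rfl]; exact EReal.coe_lt_top x)
  refine ⟨i, by omega, ?_, by rw [hi] at h1; exact h1⟩
  exact not_lt.1 (Nat.find_min hex (by omega))

/-- An endpoint is allowed for `x`, so an identity valid almost everywhere on one cell passes to its
edge by continuity. -/
lemma eq_zero_of_ae_eq_zero_Ioo {G : ℝ → ℝ} {x l u : ℝ} (hlu : l < u) (hx : x ∈ Icc l u)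
    (hG : ContinuousAt G x) (h : ∀ᵐ z, z ∈ Ioo l u → G z = 0) : G x = 0 := by
  by_contra hne
  obtain ⟨p, q, hpq, hs⟩ := mem_nhds_iff_exists_Ioo_subset.1 (hG.eventually_ne hne)
  have hlt : max l p < min u q := by
    rw [max_lt_iff, lt_min_iff, lt_min_iff]
    exact ⟨⟨hlu, by linarith [hx.1, hpq.2]⟩, by linarith [hx.2, hpq.1], hpq.1.trans hpq.2⟩
  obtain ⟨z, hz, hz0⟩ := exists_mem_Ioo_of_ae h hlt
  obtain ⟨h1, h2⟩ := max_lt_iff.1 hz.1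
  obtain ⟨h3, h4⟩ := lt_min_iff.1 hz.2
  exact hs ⟨h2, h4⟩ (hz0 ⟨h1, h3⟩)

/-- The centroids of a partition cannot all move at the same speed as its edges. -/
lemma IsPartition.not_forall_centroid_shift_eq (hf : IsLogConcaveDensity f) {N : ℕ} {e : ℕ → ℝ}
    (h : IsPartition f N e) {t : ℝ} (ht : 0 < t)
    (hc : ∀ k, k + 1 < N → e (k + 1) + t ∈ core f)
    (hm : ∀ k, k < N → 0 < mass f (edge N e k + t) (edge N e (k + 1) + t))
    (heq : ∀ k, k < N → centroid f (edge N e k + t) (edge N e (k + 1) + t) =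
      cellCentroid f N e k + t) : False := by
  have hex : ∀ k, ∃ r : ℝ, k < N → ∀ᵐ x : ℝ, x ∈ cell (edge N e k) (edge N e (k + 1)) →
      f (x + t) = r * f x := by
    intro k
    by_cases hk : k < N
    · obtain ⟨r, hr⟩ := ae_eq_of_centroid_shift_eq hf ht.le (h.mass_pos hf hk) (hm k hk) (heq k hk)
      exact ⟨r, fun _ => hr⟩
    · exact ⟨0, fun h => absurd h hk⟩
  choose r hr using hex
  -- At an edge `x` both `x` and `x + t` are in the core, so `f (x + t) = r * f x` holds there with
  -- the factors of both adjacent cells.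
  have hstep : ∀ k, k + 1 < N → r (k + 1) = r k := by
    intro k hk
    set x := e (k + 1) with hx
    have hxc := h.mem_core k hk
    have hcont : ∀ s : ℝ, ContinuousAt (fun z => f (z + t) - s * f z) x := fun s => by
      have c1 : ContinuousAt f x := hf.continuousOn_core.continuousAt (isOpen_core.mem_nhds hxc)
      have c2 : ContinuousAt f (x + t) :=
        hf.continuousOn_core.continuousAt (isOpen_core.mem_nhds (hc k hk))
      have c3 : ContinuousAt (fun z => f (z + t)) x :=
        ContinuousAt.comp (f := fun z : ℝ => z + t) (g := f) c2 (by fun_prop)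
      exact c3.sub (c1.const_mul s)
    have g1 : f (x + t) - r k * f x = 0 := by
      have h1 := h.edge_lt_succ (k := k) (by omega)
      rw [edge_succ e hk] at h1
      obtain ⟨z, hz1, hz2⟩ := EReal.lt_iff_exists_real_btwn.1 h1
      have hz2' : z < x := by exact_mod_cast hz2
      refine eq_zero_of_ae_eq_zero_Ioo (G := fun z => f (z + t) - r k * f z) (x := x)
        hz2' ⟨hz2'.le, le_rfl⟩ (hcont (r k)) ?_
      filter_upwards [hr k (by omega)] with v hv hvI
      rw [hv ⟨hz1.le.trans (by exact_mod_cast hvI.1.le), by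
        rw [edge_succ e hk]; exact_mod_cast hvI.2⟩, sub_self]
    have g2 : f (x + t) - r (k + 1) * f x = 0 := by
      have h1 := h.edge_lt_succ hk
      rw [edge_succ e hk] at h1
      obtain ⟨z, hz1, hz2⟩ := EReal.lt_iff_exists_real_btwn.1 h1
      have hz1' : x < z := by exact_mod_cast hz1
      refine eq_zero_of_ae_eq_zero_Ioo (G := fun z => f (z + t) - r (k + 1) * f z) (x := x)
        hz1' ⟨le_rfl, hz1'.le⟩ (hcont (r (k + 1))) ?_
      filter_upwards [hr (k + 1) hk] with v hv hvI
      rw [hv ⟨by rw [edge_succ e hk]; exact_mod_cast hvI.1.le,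
        lt_trans (by exact_mod_cast hvI.2) hz2⟩, sub_self]
    exact mul_right_cancel₀ (hf.pos_of_mem_core hxc).ne' (by linarith)
  have hconst : ∀ k, k < N → r k = r 0 := by
    intro k
    induction k with
    | zero => exact fun _ => rfl
    | succ k ih => exact fun hk => (hstep k hk).trans (ih (by omega))
  have hall : ∀ᵐ x : ℝ, f (x + t) = r 0 * f x := by
    have : ∀ᵐ x : ℝ, ∀ k, k < N → x ∈ cell (edge N e k) (edge N e (k + 1)) →
        f (x + t) = r k * f x := by
      rw [ae_all_iff]
      intro k
      by_cases hk : k < N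
      · filter_upwards [hr k hk] with x hx _ using hx
      · exact Eventually.of_forall fun x h => absurd h hk
    filter_upwards [this] with x hx
    obtain ⟨i, hi, hxi⟩ := exists_mem_cell_edge h.pos e x
    rw [hx i hi hxi, hconst i hi]
  have hr1 : r 0 = 1 := by
    have h1 := integral_congr_ae hall
    rw [integral_add_right_eq_self (fun x => f x) t, integral_const_mul,
      hf.isDensity.integral_eq_one] at h1
    linarith
  -- With factor `1` the density is invariant under translation by `t`, hence so is its mean, which
  -- forces `t = 0`.
  have h2 : ∫ x, x * f x = ∫ x, (x - t) * f x := by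
    rw [← integral_add_right_eq_self (fun x => (x - t) * f x) t]
    refine integral_congr_ae ?_
    filter_upwards [hall] with x hx
    rw [hx, hr1]; ring
  have h3 : ∫ x, (x - t) * f x = (∫ x, x * f x) - t := by
    rw [show (fun x => (x - t) * f x) = fun x => x * f x - t * f x by ext x; ring,
      integral_sub hf.integrable_mul (hf.isDensity.integrable.const_mul t), integral_const_mul,
      hf.isDensity.integral_eq_one, mul_one]
  linarith

lemma IsStationary.le_of_same_count (hf : IsLogConcaveDensity f) {b : ℝ} {N : ℕ} {m m' : ℕ → ℝ}
    (h : IsStationary f b N m) (h' : IsStationary f b N m') :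
    ∀ k, k + 1 < N → m (k + 1) ≤ m' (k + 1) := by
  by_contra! hc
  obtain ⟨i, hi, hlt⟩ := hc
  obtain ⟨k₀, hk₀, hmax, -⟩ := exists_last_max (fun j => m (j + 1) - m' (j + 1))
    (n := N - 1) (by omega)
  set t := m (k₀ + 1) - m' (k₀ + 1) with ht
  have htpos : 0 < t := lt_of_lt_of_le (sub_pos.2 hlt) (hmax i (by omega))
  have hle : ∀ j, j + 1 < N → m (j + 1) ≤ m' (j + 1) + t := fun j hj => by
    have : m (j + 1) - m' (j + 1) ≤ t := hmax j (by omega)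
    linarith
  have hedge : ∀ j, edge N m j ≤ edge N m' j + t := edge_le_edge_add h.pos le_rfl hle
  -- Where the displacement attains its maximum `t`, both adjacent centroid inequalities must be
  -- equalities. Strict monotonicity of centroids then forces the two neighbouring edges to be
  -- displaced by exactly `t` as well.
  have local_eq : ∀ k, k + 1 < N → m (k + 1) = m' (k + 1) + t →
      (0 < mass f (edge N m' k + t) (edge N m' (k + 1) + t) ∧
        centroid f (edge N m' k + t) (edge N m' (k + 1) + t) = cellCentroid f N m' k + t ∧
        edge N m k = edge N m' k + t) ∧
      (0 < mass f (edge N m' (k + 1) + t) (edge N m' (k + 2) + t) ∧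
        centroid f (edge N m' (k + 1) + t) (edge N m' (k + 2) + t) =
          cellCentroid f N m' (k + 1) + t ∧
        edge N m (k + 2) = edge N m' (k + 2) + t) := by
    intro k hk hmk
    have hmc := h.mem_core k hk
    have e1 : edge N m' (k + 1) + t = (m (k + 1) : EReal) := by rw [edge_add_coe m' hk, hmk]
    have s1 := add_coe_lt_add_coe (h'.edge_lt_succ (k := k) (by omega)) t
    have s2 := add_coe_lt_add_coe (h'.edge_lt_succ (k := k + 1) hk) t
    have p1 : 0 < mass f (edge N m' k + t) (edge N m' (k + 1) + t) := by
      rw [e1] at s1 ⊢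
      exact mass_pos_of_right_mem hf hmc s1
    have p2 : 0 < mass f (edge N m' (k + 1) + t) (edge N m' (k + 2) + t) := by
      rw [e1] at s2 ⊢
      exact mass_pos_of_left_mem hf hmc s2
    have a1 := centroid_shift_le hf htpos.le (h'.mass_pos hf (k := k) (by omega)) p1
    have a2 := centroid_shift_le hf htpos.le (h'.mass_pos hf hk) p2
    have n1 := h.mass_pos hf (k := k) (by omega)
    have n2 := h.mass_pos hf (k := k + 1) hk
    have b1 := centroid_mono hf n1 p1 (hedge _) (hedge _)
    have b2 := centroid_mono hf n2 p2 (hedge _) (hedge _)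
    have q1 := h.edgeMap_eq k hk
    have q2 := h'.edgeMap_eq k hk
    rw [edgeMap_succ] at q1 q2
    simp only [cellCentroid] at q1 q2 ⊢
    refine ⟨⟨p1, by linarith, ?_⟩, p2, by linarith, ?_⟩
    · by_contra hne
      have hlt := lt_of_le_of_ne (hedge k) hne
      have hk0 : ∃ j, k = j + 1 := by
        rcases k with _ | j
        · simp [edge_zero] at hne
        · exact ⟨j, rfl⟩
      obtain ⟨j, rfl⟩ := hk0
      have n3 : 0 < mass f (edge N m (j + 1)) (edge N m' (j + 1) + t) := by
        rw [edge_succ m (by omega)] at hlt ⊢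
        exact mass_pos_of_left_mem hf (h.mem_core j (by omega)) hlt
      have := centroid_lt_centroid_left hf n3 hlt.le p1 s1.le
      rw [e1, ← edge_succ m hk] at this a1
      linarith
    · by_contra hne
      have hlt := lt_of_le_of_ne (hedge (k + 2)) hne
      have hk2 : k + 1 + 1 < N := by
        by_contra hk2
        rw [edge_of_le _ h.pos (by omega), edge_of_le _ h.pos (by omega)] at hne
        simp at hne
      have n3 : 0 < mass f (edge N m (k + 2)) (edge N m' (k + 2) + t) := by
        rw [edge_succ m hk2] at hlt ⊢
        exact mass_pos_of_left_mem hf (h.mem_core (k + 1) (by omega)) hlt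
      have := centroid_lt_centroid_right hf n2 (le_of_mass_pos n2) n3 hlt.le
      rw [e1, ← edge_succ m hk] at a2
      linarith
  have hdown : ∀ d, d ≤ k₀ → m (k₀ - d + 1) = m' (k₀ - d + 1) + t := by
    intro d
    induction d with
    | zero => intro _; simp only [Nat.sub_zero, ht]; ring
    | succ d ih =>
      intro hd
      have h1 := (local_eq _ (by omega) (ih (by omega))).1.2.2
      have h2 : k₀ - d = k₀ - (d + 1) + 1 := by omega
      rw [h2, edge_succ m (by omega), edge_add_coe m' (by omega)] at h1
      exact_mod_cast h1
  have hall : ∀ k, k + 1 < N → m (k + 1) = m' (k + 1) + t := by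
    intro k
    induction k with
    | zero => intro _; simpa using hdown k₀ le_rfl
    | succ k ih =>
      intro hk
      have h1 := (local_eq k (by omega) (ih (by omega))).2.2.2
      rw [edge_succ m hk, edge_add_coe m' hk] at h1
      exact_mod_cast h1
  have hcells : ∀ k, k < N → 0 < mass f (edge N m' k + t) (edge N m' (k + 1) + t) ∧
      centroid f (edge N m' k + t) (edge N m' (k + 1) + t) = cellCentroid f N m' k + t := by
    intro k hk
    rcases k with _ | k
    · have := (local_eq 0 (by omega) (hall 0 (by omega))).1
      exact ⟨this.1, this.2.1⟩
    · have := (local_eq k hk (hall k hk)).2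
      exact ⟨this.1, this.2.1⟩
  exact h'.not_forall_centroid_shift_eq hf htpos
    (fun k hk => by rw [← hall k hk]; exact h.mem_core k hk)
    (fun k hk => (hcells k hk).1) (fun k hk => (hcells k hk).2)

/-- For a nonnegative bias, stationary partitions with more cells have smaller distortion. -/
theorem IsStationary.distortion_lt_of_nonneg (hf : IsLogConcaveDensity f) {b : ℝ} (hb : 0 ≤ b)
    {K N : ℕ} {m m' : ℕ → ℝ} (h : IsStationary f b K m) (h' : IsStationary f b N m')
    (hKN : K < N) : distortion f N m' < distortion f K m := by
  obtain ⟨d, rfl⟩ : ∃ d, N = K + d + 1 := ⟨N - K - 1, by omega⟩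
  induction d generalizing K m with
  | zero =>
    obtain ⟨e, he, hlt⟩ := h.exists_succ hf hb h' hKN
    -- Uniqueness identifies the partition just built with `m'`.
    rw [distortion_congr fun k hk => le_antisymm (h'.le_of_same_count hf he k hk)
      (he.le_of_same_count hf h' k hk)]
    exact hlt
  | succ d ih =>
    obtain ⟨e, he, hlt⟩ := h.exists_succ hf hb h' hKN
    have e1 : K + (d + 1) + 1 = K + 1 + d + 1 := by omega
    rw [e1] at h' ⊢
    exact (ih he h' (by omega)).trans hlt

/-! ### Reflection -/

/-- Reflection exchanges the closed and the open end of a cell, which affects only a null set. -/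
lemma setIntegral_cell_comp_neg (h : ℝ → ℝ) (a y : EReal) :
    ∫ x in cell (-y) (-a), h (-x) = ∫ x in cell a y, h x := by
  rw [← integral_indicator (measurableSet_cell _ _), ← integral_indicator (measurableSet_cell _ _),
    ← integral_neg_eq_self]
  refine integral_congr_ae ?_
  filter_upwards [compl_mem_ae_iff.2 (measure_singleton (μ := volume) a.toReal),
    compl_mem_ae_iff.2 (measure_singleton (μ := volume) y.toReal)] with x hxa hxy
  have hxa' : (x : EReal) ≠ a := fun hc => hxa (by rw [← hc]; simp)
  have hxy' : (x : EReal) ≠ y := fun hc => hxy (by rw [← hc]; simp)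
  have : -x ∈ cell (-y) (-a) ↔ x ∈ cell a y := by
    rw [mem_cell, mem_cell, EReal.coe_neg, EReal.neg_le_neg_iff, EReal.neg_lt_neg_iff,
      le_iff_lt_or_eq, le_iff_lt_or_eq]
    simp only [hxy', hxa'.symm, or_false, and_comm]
  by_cases hx : x ∈ cell a y
  · rw [indicator_of_mem hx, indicator_of_mem (this.2 hx), neg_neg]
  · rw [indicator_of_notMem hx, indicator_of_notMem (fun hc => hx (this.1 hc))]

lemma mass_comp_neg (f : ℝ → ℝ) (a y : EReal) :
    mass (fun x => f (-x)) (-y) (-a) = mass f a y := setIntegral_cell_comp_neg f a y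

lemma moment_comp_neg (f : ℝ → ℝ) (a y : EReal) :
    moment (fun x => f (-x)) (-y) (-a) = -moment f a y := by
  rw [moment, moment, ← integral_neg, ← setIntegral_cell_comp_neg (fun x => -(x * f x)) a y]
  congr 1; ext x; ring

lemma centroid_comp_neg (f : ℝ → ℝ) (a y : EReal) :
    centroid (fun x => f (-x)) (-y) (-a) = -centroid f a y := by
  rw [centroid, centroid, mass_comp_neg, moment_comp_neg, neg_div]

lemma cellCost_comp_neg (f : ℝ → ℝ) (u : ℝ) (a y : EReal) :
    cellCost (fun x => f (-x)) (-u) (-y) (-a) = cellCost f u a y := by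
  rw [cellCost, cellCost, ← setIntegral_cell_comp_neg (fun x => (x - u) ^ 2 * f x) a y]
  congr 1; ext x; ring

lemma mem_core_comp_neg {x : ℝ} : x ∈ core (fun x => f (-x)) ↔ -x ∈ core f := by
  have h := (Homeomorph.neg ℝ).preimage_interior (Function.support f)
  have h2 : (Homeomorph.neg ℝ) ⁻¹' Function.support f = Function.support fun x => f (-x) := rfl
  rw [h2] at h
  rw [core, ← h]
  rfl

/-- The reflection of a partition into `N` cells. -/
def reflect (N : ℕ) (e : ℕ → ℝ) (k : ℕ) : ℝ := -e (N - k)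

lemma edge_reflect {N k : ℕ} (e : ℕ → ℝ) (hN : 0 < N) (hk : k ≤ N) :
    edge N (reflect N e) k = -edge N e (N - k) := by
  rcases k with _ | k
  · rw [edge_zero, Nat.sub_zero, edge_of_le e hN le_rfl, EReal.neg_top]
  · by_cases h1 : k + 1 < N
    · obtain ⟨j, hj⟩ : ∃ j, N - (k + 1) = j + 1 := ⟨N - k - 2, by omega⟩
      rw [edge_succ _ h1, reflect, hj, edge_succ _ (by omega), EReal.coe_neg]
    · rw [edge_of_le _ hN (by omega), show N - (k + 1) = 0 by omega, edge_zero, EReal.neg_bot]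

lemma cellCentroid_reflect {N k : ℕ} (e : ℕ → ℝ) (hk : k < N) :
    cellCentroid (fun x => f (-x)) N (reflect N e) k = -cellCentroid f N e (N - 1 - k) := by
  rw [cellCentroid, cellCentroid, edge_reflect e (by omega) hk.le, edge_reflect e (by omega) hk,
    centroid_comp_neg, show N - k = N - 1 - k + 1 by omega, show N - (k + 1) = N - 1 - k by omega]

lemma distortion_reflect {N : ℕ} (e : ℕ → ℝ) :
    distortion (fun x => f (-x)) N (reflect N e) = distortion f N e := by
  rw [distortion, distortion, ← Finset.sum_range_reflect]
  refine Finset.sum_congr rfl fun j hj => ?_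
  have hj := Finset.mem_range.1 hj
  rw [cellCentroid_reflect e (by omega), edge_reflect e (by omega) (by omega),
    edge_reflect e (by omega) (by omega), cellCost_comp_neg,
    show N - 1 - (N - 1 - j) = j by omega, show N - (N - 1 - j) = j + 1 by omega,
    show N - (N - 1 - j + 1) = j by omega]

lemma IsStationary.reflect {b : ℝ} {N : ℕ} {e : ℕ → ℝ} (h : IsStationary f b N e) :
    IsStationary (fun x => f (-x)) (-b) N (reflect N e) where
  pos := h.pos
  mem_core k hk := by
    obtain ⟨j, hj⟩ : ∃ j, N - (k + 1) = j + 1 := ⟨N - k - 2, by omega⟩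
    rw [mem_core_comp_neg, CheapTalk.reflect, neg_neg, hj]
    exact h.mem_core j (by omega)
  lt_succ k hk := by
    obtain ⟨j, hj⟩ : ∃ j, N - (k + 2) = j + 1 := ⟨N - k - 3, by omega⟩
    rw [CheapTalk.reflect, CheapTalk.reflect, hj, show N - (k + 1) = j + 2 by omega]
    exact neg_lt_neg (h.lt_succ j (by omega))
  edgeMap_eq k hk := by
    obtain ⟨j, hj⟩ : ∃ j, N - (k + 1) = j + 1 := ⟨N - k - 2, by omega⟩
    have h1 := h.edgeMap_eq j (by omega)
    rw [edgeMap_succ] at h1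
    rw [edgeMap_succ, cellCentroid_reflect e (by omega), cellCentroid_reflect e (by omega),
      CheapTalk.reflect, hj, show N - 1 - k = j + 1 by omega, show N - 1 - (k + 1) = j by omega]
    linarith

/-- Stationary partitions with more cells have smaller distortion. -/
theorem IsStationary.distortion_lt (hf : IsLogConcaveDensity f) {b : ℝ} {K N : ℕ} {m m' : ℕ → ℝ}
    (h : IsStationary f b K m) (h' : IsStationary f b N m') (hKN : K < N) :
    distortion f N m' < distortion f K m := by
  rcases le_total 0 b with hb | hb
  · exact h.distortion_lt_of_nonneg hf hb h' hKN
  · rw [← distortion_reflect m, ← distortion_reflect m']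
    exact h.reflect.distortion_lt_of_nonneg hf.comp_neg (by linarith) h'.reflect hKN

/-! ### Equilibria are stationary partitions -/

lemma ae_sourceLaw_iff (hf : IsLogConcaveDensity f) {p : ℝ → Prop} :
    (∀ᵐ x ∂sourceLaw f, p x) ↔ ∀ᵐ x, f x ≠ 0 → p x := by
  rw [sourceLaw, ae_withDensity_iff hf.isDensity.measurable.ennreal_ofReal]
  refine eventually_congr (Eventually.of_forall fun x => ?_)
  rw [ne_eq, ne_eq, ENNReal.ofReal_eq_zero, not_le]
  exact ⟨fun h hx => h (hf.isDensity.pos_of_ne_zero hx), fun h hx => h hx.ne'⟩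

lemma setLIntegral_cell (hf : IsLogConcaveDensity f) (u : ℝ) (a y : EReal) :
    ∫⁻ x in cell a y, ENNReal.ofReal ((x - u) ^ 2) ∂sourceLaw f =
      ENNReal.ofReal (cellCost f u a y) := by
  rw [sourceLaw, setLIntegral_withDensity_eq_setLIntegral_mul _
    hf.isDensity.measurable.ennreal_ofReal
    (g := fun x => ENNReal.ofReal ((x - u) ^ 2)) (by fun_prop) (measurableSet_cell a y),
    cellCost, ofReal_integral_eq_lintegral_ofReal (hf.integrable_sub_sq_mul u).integrableOn
    (Eventually.of_forall fun x => mul_nonneg (sq_nonneg _) (hf.isDensity.nonneg x))]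
  congr 1; ext x
  rw [Pi.mul_apply, ENNReal.ofReal_mul (sq_nonneg _), mul_comm]

lemma cellCost_nonneg (hf : IsLogConcaveDensity f) (u : ℝ) (a y : EReal) :
    0 ≤ cellCost f u a y :=
  integral_nonneg fun x => mul_nonneg (sq_nonneg _) (hf.isDensity.nonneg x)

/-- The quadratic distortion of a partition whose `k`-th cell is represented by `u k`. -/
def partitionCost (f : ℝ → ℝ) (N : ℕ) (e u : ℕ → ℝ) : ℝ :=
  ∑ k ∈ Finset.range N, cellCost f (u k) (edge N e k) (edge N e (k + 1))

lemma partitionCost_nonneg (hf : IsLogConcaveDensity f) (N : ℕ) (e u : ℕ → ℝ) :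
    0 ≤ partitionCost f N e u := Finset.sum_nonneg fun _ _ => cellCost_nonneg hf _ _ _

lemma IsPartition.edge_le_edge {N : ℕ} {e : ℕ → ℝ} (h : IsPartition f N e) {i j : ℕ}
    (hij : i ≤ j) (hj : j ≤ N) : edge N e i ≤ edge N e j := by
  induction j, hij using Nat.le_induction with
  | base => exact le_rfl
  | succ j _ ih => exact (ih (by omega)).trans (h.edge_lt_succ (by omega)).le

/-- The common source of both costs: the decoder's with `u` the action on each bin, the encoder's
with `u` that action plus `b`. -/
lemma IsPartition.lintegral_eq (hf : IsLogConcaveDensity f) {N : ℕ} {e : ℕ → ℝ}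
    (h : IsPartition f N e) {q : ℝ → ℝ} {u : ℕ → ℝ}
    (hq : ∀ᵐ x ∂sourceLaw f, ∀ k < N, x ∈ cell (edge N e k) (edge N e (k + 1)) → q x = u k) :
    ∫⁻ x, ENNReal.ofReal ((x - q x) ^ 2) ∂sourceLaw f =
      ENNReal.ofReal (partitionCost f N e u) := by
  have hU : (⋃ k ∈ Finset.range N, cell (edge N e k) (edge N e (k + 1))) = univ := by
    rw [eq_univ_iff_forall]
    intro x
    obtain ⟨i, hi, hx⟩ := exists_mem_cell_edge h.pos e x
    exact mem_biUnion (Finset.mem_coe.2 (Finset.mem_range.2 hi)) hx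
  have hd : ∀ i j, i < j → j < N →
      Disjoint (cell (edge N e i) (edge N e (i + 1))) (cell (edge N e j) (edge N e (j + 1))) :=
    fun i j hij hj => disjoint_left.2 fun x h1 h2 =>
      absurd ((h.edge_le_edge (i := i + 1) hij hj.le).trans h2.1) (not_le.2 h1.2)
  rw [← setLIntegral_univ, ← hU, lintegral_biUnion_finset ?_ fun k _ => measurableSet_cell _ _,
    partitionCost, ENNReal.ofReal_sum_of_nonneg fun k _ => cellCost_nonneg hf _ _ _]
  · refine Finset.sum_congr rfl fun k hk => ?_
    rw [← setLIntegral_cell hf]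
    refine setLIntegral_congr_fun_ae (measurableSet_cell _ _) ?_
    filter_upwards [hq] with x hx hxk
    rw [hx k (Finset.mem_range.1 hk) hxk]
  · intro i hi j hj hij
    rcases lt_or_gt_of_ne hij with h1 | h1
    · exact hd i j h1 (Finset.mem_range.1 hj)
    · exact (hd j i h1 (Finset.mem_range.1 hi)).symm

lemma sum_mass (hf : IsLogConcaveDensity f) {N : ℕ} {e : ℕ → ℝ} (h : IsPartition f N e) :
    ∑ k ∈ Finset.range N, mass f (edge N e k) (edge N e (k + 1)) = 1 := by
  have key : ∀ n ≤ N, ∑ k ∈ Finset.range n, mass f (edge N e k) (edge N e (k + 1)) =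
      mass f ⊥ (edge N e n) := by
    intro n
    induction n with
    | zero => intro _; simp [edge_zero, mass, cell_self]
    | succ n ih =>
      intro hn
      rw [Finset.sum_range_succ, ih (by omega),
        ← mass_add hf bot_le (h.edge_lt_succ (k := n) (by omega)).le]
  rw [key N le_rfl, edge_of_le e h.pos le_rfl, mass, cell_bot_top, setIntegral_univ,
    hf.isDensity.integral_eq_one]

lemma partitionCost_eq (hf : IsLogConcaveDensity f) {N : ℕ} {e : ℕ → ℝ} (h : IsPartition f N e)
    (u : ℕ → ℝ) : partitionCost f N e u = distortion f N e +
      ∑ k ∈ Finset.range N, mass f (edge N e k) (edge N e (k + 1)) *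
        (u k - cellCentroid f N e k) ^ 2 := by
  rw [partitionCost, distortion, ← Finset.sum_add_distrib]
  exact Finset.sum_congr rfl fun k hk =>
    cellCost_eq_centroid hf _ (h.mass_pos hf (Finset.mem_range.1 hk))

/-- The interior edges of a quantizer form a partition. -/
lemma HasBins.exists_isPartition (hf : IsLogConcaveDensity f) {γe : ℝ → ℝ} {N : ℕ}
    (h : HasBins f γe N) : ∃ e msg : ℕ → ℝ, IsPartition f N e ∧
      (∀ i < N, ∀ j < N, msg i = msg j → i = j) ∧
      ∀ᵐ x ∂sourceLaw f, ∀ k < N, x ∈ cell (edge N e k) (edge N e (k + 1)) → γe x = msg k := by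
  obtain ⟨m, msg, hm, h0, hlast, hinj, hae⟩ := h
  have hlow : ∀ x ∈ core f, lowerBoundary f ≤ x := fun x hx =>
    sInf_le ⟨x, core_subset_support hx, rfl⟩
  have hup : ∀ x ∈ core f, (x : EReal) < upperBoundary f := fun x hx => by
    obtain ⟨y, hy, hyc⟩ := exists_gt_mem_core hx
    exact lt_of_lt_of_le (EReal.coe_lt_coe_iff.2 hy) (le_sSup ⟨y, core_subset_support hyc, rfl⟩)
  have hN : 0 < N := by
    rcases Nat.eq_zero_or_pos N with rfl | hN
    · obtain ⟨x, hx⟩ := hf.core_nonempty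
      have h1 := (hlow x hx).trans_lt (hup x hx)
      rw [← h0, ← hlast] at h1
      exact absurd h1 (lt_irrefl _)
    · exact hN
  -- An interior edge lies strictly between the infimum and the supremum of the support, so it is a
  -- real number in the core.
  have hreal : ∀ k (hk : k + 1 < N), ∃ r ∈ core f, m ⟨k + 1, by omega⟩ = (r : EReal) := by
    intro k hk
    have h1 : lowerBoundary f < m ⟨k + 1, by omega⟩ := by
      rw [← h0]; exact hm (by simp [Fin.lt_def])
    have h2 : m ⟨k + 1, by omega⟩ < upperBoundary f := by
      rw [← hlast]; exact hm (by simp [Fin.lt_def]; omega)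
    obtain ⟨_, ⟨p, hp, rfl⟩, hp1⟩ := sInf_lt_iff.1 h1
    obtain ⟨_, ⟨q, hq, rfl⟩, hq1⟩ := lt_sSup_iff.1 h2
    have hr := EReal.coe_toReal hq1.ne_top hp1.ne_bot
    rw [← hr] at hp1 hq1
    exact ⟨_, hf.mem_core_of_lt_of_lt hp hq (EReal.coe_lt_coe_iff.1 hp1)
      (EReal.coe_lt_coe_iff.1 hq1),
      hr.symm⟩
  set e : ℕ → ℝ := fun k => if hk : k < N + 1 then (m ⟨k, hk⟩).toReal else 0 with he
  have hme : ∀ k (hk : k + 1 < N), m ⟨k + 1, by omega⟩ = (e (k + 1) : EReal) ∧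
      e (k + 1) ∈ core f := by
    intro k hk
    obtain ⟨r, hr, hmr⟩ := hreal k hk
    have : e (k + 1) = r := by simp [he, show k < N by omega, hmr]
    rw [this]; exact ⟨hmr, hr⟩
  have hpart : IsPartition f N e := ⟨hN, fun k hk => (hme k hk).2, fun k hk => by
    have h1 : m ⟨k + 1, by omega⟩ < m ⟨k + 1 + 1, by omega⟩ := hm (by simp [Fin.lt_def])
    rw [(hme k (by omega)).1, (hme (k + 1) hk).1] at h1
    exact_mod_cast h1⟩
  -- On the core, replacing the outer edges `m_L` and `m_U` by `⊥` and `⊤` does not change the bins.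
  have hiff : ∀ j (hj : j < N + 1), ∀ x ∈ core f, (m ⟨j, hj⟩ ≤ x ↔ edge N e j ≤ x) := by
    intro j hj x hx
    rcases j with _ | j
    · rw [edge_zero]
      exact iff_of_true (by rw [← Fin.zero_eta] at h0; rw [h0]; exact hlow x hx) bot_le
    · by_cases hj1 : j + 1 < N
      · rw [edge_succ e hj1, (hme j hj1).1]
      · have hjN : (⟨j + 1, hj⟩ : Fin (N + 1)) = Fin.last N := by ext; simp; omega
        rw [hjN, hlast, edge_of_le e hN (by omega)]
        exact iff_of_false (not_le.2 (hup x hx)) (not_le.2 (EReal.coe_lt_top x))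
  refine ⟨e, fun k => if hk : k < N then msg ⟨k, hk⟩ else 0, hpart, fun i hi j hj hij => ?_, ?_⟩
  · simp only [hi, hj, dite_true] at hij
    exact Fin.mk.inj_iff.1 (hinj hij)
  · rw [ae_sourceLaw_iff hf] at hae ⊢
    filter_upwards [hae, hf.ae_mem_core] with x hx hxc hx0 k hk hxk
    simp only [hk, dite_true]
    have hc := hxc hx0
    refine hx hx0 ⟨k, hk⟩ ((hiff k (by omega) x hc).2 hxk.1) ?_
    exact not_le.1 fun hle => absurd ((hiff (k + 1) (by omega) x hc).1 hle) (not_le.2 hxk.2)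

lemma exists_measurable_decoder {N : ℕ} {msg : ℕ → ℝ}
    (hinj : ∀ i < N, ∀ j < N, msg i = msg j → i = j) (v : ℕ → ℝ) :
    ∃ γd : ℝ → ℝ, Measurable γd ∧ ∀ k < N, γd (msg k) = v k := by
  refine ⟨fun y => ∑ k ∈ Finset.range N, if y = msg k then v k else 0, ?_, fun k hk => ?_⟩
  · refine Finset.measurable_sum _ fun k _ => ?_
    exact Measurable.ite (measurableSet_singleton (msg k)) measurable_const measurable_const
  · beta_reduce
    rw [Finset.sum_eq_single k]
    · simp
    · intro j hj hjk
      rw [if_neg fun h => hjk (hinj j (Finset.mem_range.1 hj) k hk h.symm)]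
    · exact fun h => absurd (Finset.mem_range.2 hk) h

/-- At an equilibrium with finitely many bins, the decoder plays the centroids, the bin edges are
the indifference points of the encoder, and the costs are given by the distortion. -/
theorem IsEquilibriumWithBins.exists_isStationary (hf : IsLogConcaveDensity f) {b : ℝ} {N : ℕ}
    {γe γd : ℝ → ℝ} (h : IsEquilibriumWithBins f b N γe γd) :
    ∃ e, IsStationary f b N e ∧ decoderCost f γe γd = ENNReal.ofReal (distortion f N e) ∧
      encoderCost f b γe γd = ENNReal.ofReal (distortion f N e + b ^ 2) := by
  obtain ⟨hNash, hbins⟩ := h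
  obtain ⟨e, msg, hpart, hinj, hae⟩ := hbins.exists_isPartition hf
  have hdec : ∀ γd' : ℝ → ℝ, decoderCost f γe γd' =
      ENNReal.ofReal (partitionCost f N e fun k => γd' (msg k)) := fun γd' =>
    hpart.lintegral_eq hf (q := fun x => γd' (γe x)) (by
      filter_upwards [hae] with x hx k hk hxk
      rw [hx k hk hxk])
  have henc : encoderCost f b γe γd =
      ENNReal.ofReal (partitionCost f N e fun k => γd (msg k) + b) := by
    rw [← hpart.lintegral_eq hf (q := fun x => γd (γe x) + b) (by
      filter_upwards [hae] with x hx k hk hxk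
      rw [hx k hk hxk])]
    simp only [encoderCost, sub_sub]
  -- Deviating to the centroids bounds the weighted sum of squared deviations by zero, and every bin
  -- has positive mass.
  have hcent : ∀ k < N, γd (msg k) = cellCentroid f N e k := by
    obtain ⟨γd', hγd', hv⟩ := exists_measurable_decoder hinj (cellCentroid f N e)
    have h1 := hNash.decoder_optimal γd' hγd'
    rw [hdec, hdec, ENNReal.ofReal_le_ofReal_iff (partitionCost_nonneg hf _ _ _),
      partitionCost_eq hf hpart, partitionCost_eq hf hpart,
      Finset.sum_eq_zero (f := fun k => mass f (edge N e k) (edge N e (k + 1)) *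
        (γd' (msg k) - cellCentroid f N e k) ^ 2) fun k hk => by
        rw [hv k (Finset.mem_range.1 hk)]; ring] at h1
    have hnn : ∀ k ∈ Finset.range N, 0 ≤ mass f (edge N e k) (edge N e (k + 1)) *
        (γd (msg k) - cellCentroid f N e k) ^ 2 := fun k _ =>
      mul_nonneg (mass_nonneg hf _ _) (sq_nonneg _)
    have h2 := (Finset.sum_eq_zero_iff_of_nonneg hnn).1
      (le_antisymm (by linarith) (Finset.sum_nonneg hnn))
    intro k hk
    have h3 := (mul_eq_zero.1 (h2 k (Finset.mem_range.2 hk))).resolve_left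
      (hpart.mass_pos hf hk).ne'
    exact sub_eq_zero.1 (pow_eq_zero_iff two_ne_zero |>.1 h3)
  -- The encoder deviates on a piece of bin `j` only, sending the message of bin `i` there. The
  -- finite cost of the complement cancels.
  have hlocal : ∀ i < N, ∀ j < N, ∀ a y : EReal, edge N e j ≤ a → y ≤ edge N e (j + 1) →
      cellCost f (cellCentroid f N e j + b) a y ≤ cellCost f (cellCentroid f N e i + b) a y := by
    intro i hi j hj a y ha hy
    classical
    set S := cell a y with hS
    have hSm : MeasurableSet S := measurableSet_cell a y
    set γe' : ℝ → ℝ := S.piecewise (fun _ => msg i) γe with hγe'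
    have h1 := hNash.encoder_optimal γe'
      (Measurable.piecewise hSm measurable_const hNash.measurable_encoder)
    have hfin : encoderCost f b γe γd ≠ ⊤ := by rw [henc]; exact ENNReal.ofReal_ne_top
    rw [encoderCost, ← lintegral_add_compl _ hSm] at hfin
    rw [encoderCost, encoderCost, ← lintegral_add_compl _ hSm,
      ← lintegral_add_compl (fun x => ENNReal.ofReal ((x - γd (γe' x) - b) ^ 2)) hSm] at h1
    have hcompl : ∫⁻ x in Sᶜ, ENNReal.ofReal ((x - γd (γe' x) - b) ^ 2) ∂sourceLaw f =
        ∫⁻ x in Sᶜ, ENNReal.ofReal ((x - γd (γe x) - b) ^ 2) ∂sourceLaw f :=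
      setLIntegral_congr_fun hSm.compl fun x hx => by
        simp only [hγe', piecewise_eq_of_notMem _ _ _ hx]
    rw [hcompl] at h1
    have h2 := (ENNReal.add_le_add_iff_right (ENNReal.add_ne_top.1 hfin).2).1 h1
    have h3 : ∫⁻ x in S, ENNReal.ofReal ((x - γd (γe x) - b) ^ 2) ∂sourceLaw f =
        ENNReal.ofReal (cellCost f (cellCentroid f N e j + b) a y) := by
      rw [← setLIntegral_cell hf]
      refine setLIntegral_congr_fun_ae hSm ?_
      filter_upwards [hae] with x hx hxS
      rw [hx j hj ⟨ha.trans hxS.1, hxS.2.trans_le hy⟩, hcent j hj, sub_sub]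
    have h4 : ∫⁻ x in S, ENNReal.ofReal ((x - γd (γe' x) - b) ^ 2) ∂sourceLaw f =
        ENNReal.ofReal (cellCost f (cellCentroid f N e i + b) a y) := by
      rw [← setLIntegral_cell hf]
      refine setLIntegral_congr_fun hSm fun x hx => ?_
      simp only [hγe', piecewise_eq_of_mem _ _ _ hx, hcent i hi, sub_sub]
    rw [h3, h4, ENNReal.ofReal_le_ofReal_iff (cellCost_nonneg hf _ _ _)] at h2
    exact h2
  have hstat : IsStationary f b N e := by
    refine ⟨hpart, fun k hk => ?_⟩
    have hcc := hpart.cellCentroid_lt_succ hf hk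
    have hkc := hpart.mem_core k hk
    have hl := hpart.edge_lt_succ (k := k) (by omega)
    have hr := hpart.edge_lt_succ hk
    rw [edgeMap_succ]
    rw [edge_succ e hk] at hl hr
    set c := cellCentroid f N e k
    set c' := cellCentroid f N e (k + 1)
    refine le_antisymm (not_lt.1 fun hlt => ?_) (not_lt.1 fun hlt => ?_)
    -- If the indifference point were to the right of the edge, a short interval just right of the
    -- edge would belong to bin `k + 1` although all of it prefers the action of bin `k`. The other
    -- case is symmetric.
    · have h1 : (e (k + 1) : EReal) < min (edge N e (k + 2)) (((c + c') / 2 + b : ℝ) : EReal) :=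
        lt_min hr (by exact_mod_cast hlt)
      obtain ⟨z, hz1, hz2⟩ := EReal.lt_iff_exists_real_btwn.1 h1
      obtain ⟨hz3, hz4⟩ := lt_min_iff.1 hz2
      have hz4' : z < (c + c') / 2 + b := by exact_mod_cast hz4
      have h2 := hlocal k (by omega) (k + 1) hk (e (k + 1)) z (edge_succ e hk).le hz3.le
      have hm := mass_pos_of_left_mem hf hkc hz1
      rw [cellCost_eq hf, cellCost_eq hf, moment_eq _ _ hm] at h2
      have h3 := centroid_lt_right hf hm
      nlinarith [mul_pos (sub_pos.2 hcc) hm]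
    · have h1 : max (edge N e k) (((c + c') / 2 + b : ℝ) : EReal) < (e (k + 1) : EReal) :=
        max_lt hl (by exact_mod_cast hlt)
      obtain ⟨z, hz1, hz2⟩ := EReal.lt_iff_exists_real_btwn.1 h1
      obtain ⟨hz3, hz4⟩ := max_lt_iff.1 hz1
      have hz4' : (c + c') / 2 + b < z := by exact_mod_cast hz4
      have h2 := hlocal (k + 1) hk k (by omega) z (e (k + 1)) hz3.le (edge_succ e hk).ge
      have hm := mass_pos_of_right_mem hf hkc hz2
      rw [cellCost_eq hf, cellCost_eq hf, moment_eq _ _ hm] at h2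
      have h3 := left_lt_centroid hf hm
      nlinarith [mul_pos (sub_pos.2 hcc) hm]
  refine ⟨e, hstat, ?_, ?_⟩
  · rw [hdec, partitionCost_eq hf hpart, Finset.sum_eq_zero, add_zero]
    intro k hk
    rw [hcent k (Finset.mem_range.1 hk)]; ring
  · rw [henc, partitionCost_eq hf hpart]
    congr 2
    rw [Finset.sum_congr rfl (g := fun k => mass f (edge N e k) (edge N e (k + 1)) * b ^ 2)
      fun k hk => by rw [hcent k (Finset.mem_range.1 hk)]; ring, ← Finset.sum_mul,
      sum_mass hf hpart, one_mul]

lemma distortion_nonneg (hf : IsLogConcaveDensity f) (N : ℕ) (e : ℕ → ℝ) :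
    0 ≤ distortion f N e := partitionCost_nonneg hf N e _

end CheapTalk

end

theorem theorem7 (f : ℝ → ℝ) (hf : CheapTalk.IsDensity f) (hlc : CheapTalk.IsLogConcave f)
    (b : ℝ) :
    (∀ (N : ℕ) (γe γd : ℝ → ℝ), CheapTalk.IsEquilibriumWithBins f b N γe γd →
      CheapTalk.decoderCost f γe γd < ⊤ ∧
      CheapTalk.encoderCost f b γe γd =
        CheapTalk.decoderCost f γe γd + ENNReal.ofReal (b ^ 2)) ∧
    (∀ (K N : ℕ), 1 ≤ K → K < N → ∀ (γe γd γe' γd' : ℝ → ℝ),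
      CheapTalk.IsEquilibriumWithBins f b K γe γd →
      CheapTalk.IsEquilibriumWithBins f b N γe' γd' →
      CheapTalk.decoderCost f γe' γd' < CheapTalk.decoderCost f γe γd ∧
      CheapTalk.encoderCost f b γe' γd' < CheapTalk.encoderCost f b γe γd) := by
  have hF : CheapTalk.IsLogConcaveDensity f := ⟨hf, hlc⟩
  refine ⟨fun N γe γd h => ?_, fun K N _ hKN γe γd γe' γd' h h' => ?_⟩
  · obtain ⟨e, -, hd, he⟩ := h.exists_isStationary hF
    rw [hd, he, ENNReal.ofReal_add (CheapTalk.distortion_nonneg hF N e) (sq_nonneg b)]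
    exact ⟨ENNReal.ofReal_lt_top, rfl⟩
  · obtain ⟨e, hs, hd, he⟩ := h.exists_isStationary hF
    obtain ⟨e', hs', hd', he'⟩ := h'.exists_isStationary hF
    have hlt := hs.distortion_lt hF hs' hKN
    have h0 := CheapTalk.distortion_nonneg hF N e'
    rw [hd, hd', he, he']
    exact ⟨(ENNReal.ofReal_lt_ofReal_iff (by linarith)).2 hlt,
      (ENNReal.ofReal_lt_ofReal_iff (by linarith [sq_nonneg b])).2 (by linarith)⟩
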